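/- **Setting.** Let $0\le q<1$, $M\in\mathbb R$, let $c_0(\cdot)$ be a bounded function of the dimension, and let $p=p_n$ be a sequence of dimensions. Let $\mathcal U_\tau(q,c_0(p),M)$ be the set of $p\times p$ covariance matrices $\Sigma=[\sigma_{ij}]$ with $\sigma_{ii}\le M$ and $\sum_{j}|\sigma_{ij}|^q\le c_0(p)$ for all $i$ (for $q=0$ the sum counts the nonzero entries). For a matrix $A=[a_{ij}]$ put $T_s(A)=[a_{ij}\mathbf 1(|a_{ij}|\ge s)]$, and let $\|\cdot\|_F$ be the Frobenius norm. For nonnegative random variables, $A_n=O_P(B_n)$ means that for every $\delta>0$ there is $K$ with $P(A_n>KB_n)\le\delta$ for all large $n$; $A_n=\Omega_P(B_n)$ means $A_n=O_P(B_n)$ and $B_n=O_P(A_n)$; $A_n=B_n(1+o_P(1))$ means $P(|A_n-B_n|>\delta B_n)\to0$ for every $\delta>0$. For each $n$ let $X_1,\dots,X_n$ be i.i.d. $p$-variate Gaussian with arbitrary mean and covariance matrix $\Sigma=\Sigma_n\in\mathcal U_\tau(q,c_0(p),M)$. Let $B_n=n\varepsilon(n,p)$ be integers with $0<B_n<n$,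 and let $\hat\Sigma_1$ and $\hat\Sigma_2$ be the (mean-centred, $1/\text{size}$-normalized) sample covariance matrices of the first $n-B_n$ and of the last $B_n$ observations. Let $J=J_n\ge2$, and consider the thresholds in the grid $\{j\sqrt{\log p/n}:0\le j\le J\}$. Let $\hat s$ be a minimizer over the grid of $\|T_s(\hat\Sigma_1)-\hat\Sigma_2\|_F^2$ (the cross-validated threshold), and $o=o(\Sigma)$ a minimizer over the grid of $\|T_s(\hat\Sigma_1)-\Sigma\|_F^2$ (the oracle threshold). Put $r_n=c_0(p)\,p\left(\frac{\log p}{n}\right)^{1-q/2}$. **Theorem 4.** Suppose that $\|T_o(\hat\Sigma_1)-\Sigma\|_F^2=\Omega_P(r_n)$ and that $$(\log J)^3=o\!\left(n^{q/2}\,c_0(p)\,(\log p)^{1-q/2}\,\varepsilon(n,p)\right).$$ Then, as $n\to\infty$, $$\|T_{\hat s}(\hat\Sigma_1)-\Sigma\|_F=\|T_o(\hat\Sigma_1)-\Sigma\|_F\,(1+o_P(1)),$$ and so $\|T_{\hat s}(\hat\Sigma_1)-\Sigma\|_F^2=\Omega_P(r_n)$. Moreover, if also $\frac{\log p}{n}\to0$,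 $J_n\to\infty$ and $\varepsilon(n,p)$ stays bounded away from $1$, then $r_n$ is the exact worst-case rate over $\mathcal U_\tau(q,c_0(p),M)$ both of the cross-validated and of the oracle threshold: writing $L_n(\Sigma)$ for $\|T_{\hat s}(\hat\Sigma_1)-\Sigma\|_F^2$ or for $\|T_{o(\Sigma)}(\hat\Sigma_1)-\Sigma\|_F^2$, for every $\delta>0$ there are $K,k>0$ such that for all large $n$, $P(L_n(\Sigma)>Kr_n)\le\delta$ for every Gaussian law with covariance $\Sigma\in\mathcal U_\tau(q,c_0(p),M)$, and $P(L_n(\Sigma)<kr_n)\le\delta$ for at least one such law. -/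

import Mathlib

open MeasureTheory ProbabilityTheory Filter Topology Asymptotics
open scoped Matrix.Norms.Frobenius

noncomputable section

/-- `|x|^q` with the convention `|0|^0 = 0`, so that `q = 0` gives the indicator of `x ≠ 0`. -/
def absPow (q x : ℝ) : ℝ := if x = 0 then 0 else |x| ^ q

/-- The class `U_τ(q, c₀, M)` of `p × p` covariance matrices. -/
def sparseClass (p : ℕ) (q c₀ M : ℝ) : Set (Matrix (Fin p) (Fin p) ℝ) :=
  {S | S.PosSemidef ∧ (∀ i, S i i ≤ M) ∧ ∀ i, ∑ j, absPow q (S i j) ≤ c₀}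

/-- Hard thresholding of a matrix at level `s`: entries with `|a_ij| ≥ s` are kept, all others are
replaced by `0`. -/
def hardThreshold {p : ℕ} (s : ℝ) (A : Matrix (Fin p) (Fin p) ℝ) : Matrix (Fin p) (Fin p) ℝ :=
  Matrix.of fun i j => if s ≤ |A i j| then A i j else 0

/-- `n` observations in `ℝ^p`. -/
abbrev Sample (n p : ℕ) : Type := Fin n → EuclideanSpace ℝ (Fin p)

/-- The law of `n` i.i.d. observations from the Gaussian distribution with mean `ν` and covariance
matrix `S`. -/
def gaussianSample (n : ℕ) {p : ℕ} (ν : EuclideanSpace ℝ (Fin p)) (S : Matrix (Fin p) (Fin p) ℝ) :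
    Measure (Sample n p) :=
  Measure.pi fun _ : Fin n => multivariateGaussian ν S

/-- The sample mean of the observations with indices in `I`. -/
def sampleMean {n p : ℕ} (I : Finset (Fin n)) (X : Sample n p) (a : Fin p) : ℝ :=
  (I.card : ℝ)⁻¹ * ∑ k ∈ I, X k a

/-- The (centred) sample covariance matrix of the observations with indices in `I`. -/
def sampleCov {n p : ℕ} (I : Finset (Fin n)) (X : Sample n p) : Matrix (Fin p) (Fin p) ℝ :=
  Matrix.of fun a b =>
    (I.card : ℝ)⁻¹ * ∑ k ∈ I, (X k a - sampleMean I X a) * (X k b - sampleMean I X b)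

/-- The sample covariance of the training part, i.e. of all but the last `B` observations. -/
def trainCov {n p : ℕ} (B : ℕ) (X : Sample n p) : Matrix (Fin p) (Fin p) ℝ :=
  sampleCov (Finset.univ.filter fun k : Fin n => (k : ℕ) + B < n) X

/-- The sample covariance of the validation part, i.e. of the last `B` observations. -/
def validCov {n p : ℕ} (B : ℕ) (X : Sample n p) : Matrix (Fin p) (Fin p) ℝ :=
  sampleCov (Finset.univ.filter fun k : Fin n => n ≤ (k : ℕ) + B) X

/-- The step `√(log p / n)` of the threshold grid. -/
def gridStep (n p : ℕ) : ℝ := √(Real.log p / n)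

/-- The threshold `j h` minimizes the squared Frobenius distance between `T_s(A)` and `target` over
the grid `s ∈ {i h : 0 ≤ i ≤ J}`. With the validation covariance as target, `j h` is a
cross-validated threshold; with the true covariance as target, it is an oracle threshold. -/
def IsGridMinimizer {p : ℕ} (J : ℕ) (h : ℝ) (A target : Matrix (Fin p) (Fin p) ℝ) (j : ℕ) : Prop :=
  j ≤ J ∧ ∀ i ≤ J, ‖hardThreshold (j * h) A - target‖ ^ 2 ≤ ‖hardThreshold (i * h) A - target‖ ^ 2

/-- The Frobenius rate `c₀ p (log p / n)^{1 - q/2}`. -/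
def frobRate (q c₀ : ℝ) (n p : ℕ) : ℝ := c₀ * p * (Real.log p / n) ^ (1 - q / 2)

/-- `A = O_P(B)`. -/
def IsBigOInProb {Ω : ℕ → Type} [∀ n, MeasurableSpace (Ω n)] (P : ∀ n, Measure (Ω n))
    (A B : ∀ n, Ω n → ℝ) : Prop :=
  ∀ δ > 0, ∃ K > 0, ∀ᶠ n in atTop, P n {ω | K * |B n ω| < |A n ω|} ≤ ENNReal.ofReal δ

/-- `A = Ω_P(B)`, meaning `A = O_P(B)` and `B = O_P(A)`. -/
def IsExactOrderInProb {Ω : ℕ → Type} [∀ n, MeasurableSpace (Ω n)] (P : ∀ n, Measure (Ω n))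
    (A B : ∀ n, Ω n → ℝ) : Prop :=
  IsBigOInProb P A B ∧ IsBigOInProb P B A

/-- `A = B (1 + o_P(1))`. -/
def IsEquivalentInProb {Ω : ℕ → Type} [∀ n, MeasurableSpace (Ω n)] (P : ∀ n, Measure (Ω n))
    (A B : ∀ n, Ω n → ℝ) : Prop :=
  ∀ δ > 0, Tendsto (fun n => P n {ω | δ * |B n ω| < |A n ω - B n ω|}) atTop (𝓝 0)

/-- The supremum of the random loss `L` over the parameter sets `C n` is of exact order `r`:
`L = O_P(r)` uniformly over the parameters, and no smaller order holds uniformly. -/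
def HasExactWorstCaseRate {Ω Θ : ℕ → Type} [∀ n, MeasurableSpace (Ω n)]
    (P : ∀ n, Θ n → Measure (Ω n)) (L : ∀ n, Θ n → Ω n → ℝ) (C : ∀ n, Set (Θ n))
    (r : ℕ → ℝ) : Prop :=
  (∀ δ > 0, ∃ K > 0, ∀ᶠ n in atTop, ∀ θ ∈ C n,
    P n θ {ω | K * r n < L n θ ω} ≤ ENNReal.ofReal δ) ∧
  (∀ δ > 0, ∃ k > 0, ∀ᶠ n in atTop, ∃ θ ∈ C n,
    P n θ {ω | L n θ ω < k * r n} ≤ ENNReal.ofReal δ)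

end

/-!
Write `T_i` for the training covariance thresholded at the `i`-th grid point, `V` for the validation
covariance and `S` for the true covariance. Expanding the square,
`‖T_i - V‖² = ‖T_i - S‖² - 2 ⟨T_i - S, V - S⟩ + ‖V - S‖²`, so cross-validation minimizes the loss up
to the linear term. If `|⟨T_i - S, V - S⟩| ≤ τ ‖T_i - S‖` for all grid points, then the
cross-validated and the oracle loss (not squared) differ by at most `2 τ`
(`IsGridMinimizer.norm_sub_le`).

The training and the validation part are independent, so conditionally on the training part each
`⟨T_i - S, V - S⟩` is a fixed linear functional of the error of a Gaussian sample covariance. Such a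
functional is a centred quadratic form in Gaussian vectors, up to a bias of order `‖S‖ / B`;
diagonalizing the form gives an exponential tail bound (`measureReal_frobInner_sampleCov_le`).
Matrices in the sparse class have bounded row sums, so by the Schur test the scale of the form is at
most a constant times `‖T_i - S‖`. A union bound over the grid yields `τ` of order
`log J / √B + √p / B`, which is `o(√r)` by the growth condition on `log J`
(`eventually_crossValidation_le_oracle`). This comparison is uniform over the class, and together
with the assumed exact order of the oracle loss it gives the first two claims.

For the worst-case rate, the lower bound is attained at the given sequence of covariances. The upper
bound for the oracle is the usual one for hard thresholding (`uniform_oracle_le`): with high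
probability all entries of the training covariance are accurate up to half of a grid threshold
`K √(log p / n)`, and thresholding there has a squared error of order `r` over the sparse class. The
comparison carries this bound over to the cross-validated threshold.
-/

noncomputable section

/-! ### Quadratic forms of Gaussian vectors -/

lemma exp_mul_sq_gaussianPDF (u g : ℝ) :
    gaussianPDFReal 0 1 g * Real.exp (u * (g ^ 2 - 1)) =
      (√(2 * Real.pi))⁻¹ * Real.exp (-u) * Real.exp (-(1 / 2 - u) * g ^ 2) := by
  simp only [gaussianPDFReal, sub_zero, NNReal.coe_one, mul_one]
  rw [mul_assoc, mul_assoc, ← Real.exp_add, ← Real.exp_add]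
  ring_nf

lemma integrable_exp_mul_sq_gaussianReal {u : ℝ} (hu : u < 1 / 2) :
    Integrable (fun g => Real.exp (u * (g ^ 2 - 1))) (gaussianReal 0 1) := by
  rw [gaussianReal_of_var_ne_zero 0 one_ne_zero, gaussianPDF_def,
    integrable_withDensity_iff_integrable_smul' (by fun_prop) (by simp)]
  simp only [ENNReal.toReal_ofReal (gaussianPDFReal_nonneg _ _ _), smul_eq_mul,
    exp_mul_sq_gaussianPDF]
  exact (integrable_exp_neg_mul_sq (by linarith)).const_mul _

/-- The squared standard Gaussian is sub-exponential. -/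
lemma integral_exp_mul_sq_gaussianReal_le {u : ℝ} (hu : |u| ≤ 1 / 4) :
    ∫ g, Real.exp (u * (g ^ 2 - 1)) ∂gaussianReal 0 1 ≤ Real.exp (4 * u ^ 2) := by
  obtain ⟨h1, h2⟩ := abs_le.mp hu
  rw [integral_gaussianReal_eq_integral_smul one_ne_zero]
  simp only [smul_eq_mul, exp_mul_sq_gaussianPDF]
  rw [integral_const_mul, integral_gaussian]
  have hpos : 0 < 1 - 2 * u := by linarith
  -- `√(2π)⁻¹ √(π / (1/2 - u)) = (1 - 2u)^(-1/2)`
  have e1 : (√(2 * Real.pi))⁻¹ * √(Real.pi / (1 / 2 - u)) = (√(1 - 2 * u))⁻¹ := by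
    rw [← Real.sqrt_inv, ← Real.sqrt_inv, ← Real.sqrt_mul (by positivity)]
    congr 1
    have := Real.pi_pos
    have : (1 / 2 - u) ≠ 0 := by linarith
    field_simp
  have e2 : (√(1 - 2 * u))⁻¹ = Real.exp (-(1 / 2) * Real.log (1 - 2 * u)) := by
    rw [Real.sqrt_eq_rpow, ← Real.rpow_neg hpos.le, Real.rpow_def_of_pos hpos]
    ring_nf
  have hlog : -Real.log (1 - 2 * u) ≤ 2 * u + 8 * u ^ 2 := by
    have hx : |2 * u| ≤ 1 / 2 := by rw [abs_mul, abs_two]; linarith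
    have hb := Real.abs_log_sub_add_sum_range_le (hx.trans_lt (by norm_num)) 1
    have h3 : |2 * u| ^ 2 / (1 - |2 * u|) ≤ 8 * u ^ 2 := by
      rw [sq_abs, div_le_iff₀ (by linarith)]
      nlinarith [sq_nonneg (2 * u)]
    simp only [Finset.sum_range_one, zero_add, pow_one, Nat.cast_zero, div_one] at hb
    linarith [(abs_le.mp (hb.trans h3)).1]
  calc _ = ((√(2 * Real.pi))⁻¹ * √(Real.pi / (1 / 2 - u))) * Real.exp (-u) := by ring
    _ = Real.exp (-(1 / 2) * Real.log (1 - 2 * u) + -u) := by rw [e1, e2, Real.exp_add]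
    _ ≤ _ := Real.exp_le_exp.mpr (by linarith)

/-- The quadratic form `x ↦ xᵀ A x` of a matrix. -/
def quadForm {p : ℕ} (A : Matrix (Fin p) (Fin p) ℝ) (x : EuclideanSpace ℝ (Fin p)) : ℝ :=
  ∑ a, ∑ b, A a b * (x a * x b)

/-- The entrywise (Frobenius) inner product of two matrices. -/
def frobInner {p : ℕ} (A B : Matrix (Fin p) (Fin p) ℝ) : ℝ := ∑ a, ∑ b, A a b * B a b

lemma frobInner_self {p : ℕ} (A : Matrix (Fin p) (Fin p) ℝ) : frobInner A A = ‖A‖ ^ 2 := by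
  rw [Matrix.frobenius_norm_def, ← Real.sqrt_eq_rpow, Real.sq_sqrt (by positivity)]
  simp [frobInner, sq]

lemma frobInner_eq_trace {p : ℕ} (A B : Matrix (Fin p) (Fin p) ℝ) (hA : A.IsSymm) :
    frobInner A B = (A * B).trace := by
  simp only [frobInner, Matrix.trace, Matrix.diag, Matrix.mul_apply]
  rw [Finset.sum_comm]
  simp [hA.apply]

lemma quadForm_eq {p : ℕ} (A : Matrix (Fin p) (Fin p) ℝ) (x : EuclideanSpace ℝ (Fin p)) :
    quadForm A x = inner ℝ x (Matrix.toEuclideanLin A x) := by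
  simp only [quadForm, PiLp.inner_apply, Matrix.toLpLin_apply, Matrix.mulVec, dotProduct,
    RCLike.inner_apply, conj_trivial, Finset.sum_mul]
  exact Finset.sum_congr rfl fun a _ => Finset.sum_congr rfl fun b _ => by ring

lemma continuous_quadForm {p : ℕ} (A : Matrix (Fin p) (Fin p) ℝ) : Continuous (quadForm A) := by
  unfold quadForm; fun_prop

/-- In an orthonormal eigenbasis, a quadratic form is a weighted sum of squares. -/
lemma quadForm_sum_eigenvectorBasis {p : ℕ} {A : Matrix (Fin p) (Fin p) ℝ} (hA : A.IsHermitian)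
    (g : Fin p → ℝ) :
    quadForm A (∑ i, g i • hA.eigenvectorBasis i) = ∑ i, hA.eigenvalues i * g i ^ 2 := by
  have h (i : Fin p) : Matrix.toEuclideanLin A (hA.eigenvectorBasis i) =
      hA.eigenvalues i • hA.eigenvectorBasis i := by
    ext j
    simpa using congrFun (hA.mulVec_eigenvectorBasis i) j
  rw [quadForm_eq, map_sum]
  simp only [map_smul, h, sum_inner, inner_sum, real_inner_smul_left, real_inner_smul_right,
    hA.eigenvectorBasis.inner_eq_ite]
  simp
  refine Finset.sum_congr rfl fun i _ => by ring

lemma sum_eigenvalues_sq {p : ℕ} {A : Matrix (Fin p) (Fin p) ℝ} (hA : A.IsHermitian) :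
    ∑ i, hA.eigenvalues i ^ 2 = (A * A).trace := by
  conv_rhs => rw [hA.spectral_theorem, ← map_mul]
  rw [Unitary.conjStarAlgAut_apply, Matrix.trace_mul_cycle]
  simp [sq]

/-- By rotation invariance, a quadratic form of a standard Gaussian vector is a sum of independent
scaled squares, so its exponential moments factorize over the eigenvalues. -/
lemma integral_exp_quadForm_stdGaussian {p : ℕ} {A : Matrix (Fin p) (Fin p) ℝ}
    (hA : A.IsHermitian) {l κ : ℝ} (hκ : (A * A).trace ≤ κ ^ 2) (hl : |l| * κ ≤ 1 / 4)
    (hκ0 : 0 ≤ κ) :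
    Integrable (fun x => Real.exp (l * (quadForm A x - A.trace)))
      (stdGaussian (EuclideanSpace ℝ (Fin p))) ∧
    ∫ x, Real.exp (l * (quadForm A x - A.trace)) ∂stdGaussian (EuclideanSpace ℝ (Fin p)) ≤
      Real.exp (4 * (l * κ) ^ 2) := by
  have hsum : ∑ i, hA.eigenvalues i ^ 2 ≤ κ ^ 2 := (sum_eigenvalues_sq hA).trans_le hκ
  have htr : A.trace = ∑ i, hA.eigenvalues i := by simpa using hA.trace_eq_sum_eigenvalues
  have heig (i : Fin p) : |l * hA.eigenvalues i| ≤ 1 / 4 := by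
    have : |hA.eigenvalues i| ≤ κ := abs_le_of_sq_le_sq
      ((Finset.single_le_sum (f := fun i => hA.eigenvalues i ^ 2)
        (fun i _ => sq_nonneg _) (Finset.mem_univ i)).trans hsum) hκ0
    rw [abs_mul]
    exact (mul_le_mul_of_nonneg_left this (abs_nonneg _)).trans hl
  have hfac (g : Fin p → ℝ) :
      Real.exp (l * (quadForm A (∑ i, g i • hA.eigenvectorBasis i) - A.trace)) =
      ∏ i, Real.exp (l * hA.eigenvalues i * (g i ^ 2 - 1)) := by
    rw [quadForm_sum_eigenvectorBasis hA, htr, ← Real.exp_sum, ← Finset.sum_sub_distrib,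
      Finset.mul_sum]
    congr 1
    exact Finset.sum_congr rfl fun i _ => by ring
  have hm : Measurable fun g : Fin p → ℝ => ∑ i, g i • hA.eigenvectorBasis i := by fun_prop
  have hc : Continuous fun x => Real.exp (l * (quadForm A x - A.trace)) := by
    have := continuous_quadForm A
    fun_prop
  rw [stdGaussian_eq_map_pi_orthonormalBasis hA.eigenvectorBasis,
    integrable_map_measure hc.aestronglyMeasurable hm.aemeasurable,
    integral_map hm.aemeasurable hc.aestronglyMeasurable]
  simp only [Function.comp_def, hfac]
  refine ⟨Integrable.fintype_prod fun i => integrable_exp_mul_sq_gaussianReal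
    ((le_abs_self _).trans_lt ((heig i).trans_lt (by norm_num))), ?_⟩
  rw [integral_fintype_prod_eq_prod
    (f := fun i x => Real.exp (l * hA.eigenvalues i * (x ^ 2 - 1)))]
  calc _ ≤ ∏ i, Real.exp (4 * (l * hA.eigenvalues i) ^ 2) :=
        Finset.prod_le_prod (fun i _ => integral_nonneg fun _ => (Real.exp_pos _).le)
          fun i _ => integral_exp_mul_sq_gaussianReal_le (heig i)
    _ ≤ _ := by
        rw [← Real.exp_sum]
        refine Real.exp_le_exp.mpr ?_
        simp only [mul_pow, ← mul_assoc, ← Finset.mul_sum]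
        gcongr

/-- A Gaussian law is the image of the standard one under any factorization of its covariance, not
only under the symmetric square root by which it is defined. -/
lemma multivariateGaussian_eq_map {p : ℕ} (ν : EuclideanSpace ℝ (Fin p))
    (R : Matrix (Fin p) (Fin p) ℝ) :
    multivariateGaussian ν (R.conjTranspose * R) =
      (stdGaussian (EuclideanSpace ℝ (Fin p))).map
        (fun x => ν + Matrix.toEuclideanLin R.conjTranspose x) := by
  have hc : Continuous (Matrix.toEuclideanLin R.conjTranspose) :=
    LinearMap.continuous_of_finiteDimensional _
  apply Measure.ext_of_charFun
  ext t
  rw [charFun_multivariateGaussian (Matrix.posSemidef_conjTranspose_mul_self R), charFun_apply,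
    integral_map (by fun_prop) (by fun_prop)]
  have h (x : EuclideanSpace ℝ (Fin p)) :
      inner ℝ (Matrix.toEuclideanLin R.conjTranspose x) t =
        inner ℝ x (Matrix.toEuclideanLin R t) := by
    rw [Matrix.toEuclideanLin_conjTranspose_eq_adjoint, LinearMap.adjoint_inner_left]
  have h2 : (t : Fin p → ℝ) ⬝ᵥ (R.conjTranspose * R).mulVec t =
      ‖Matrix.toEuclideanLin R t‖ ^ 2 := by
    rw [← real_inner_self_eq_norm_sq, EuclideanSpace.inner_eq_star_dotProduct, star_trivial,
      Matrix.toLpLin_apply, ← Matrix.mulVec_mulVec, Matrix.dotProduct_mulVec,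
      Matrix.vecMul_conjTranspose, star_trivial, star_trivial]
  simp only [inner_add_left, h, Complex.ofReal_add, add_mul, Complex.exp_add]
  rw [integral_const_mul, ← charFun_apply, charFun_stdGaussian, h2, ← Complex.exp_add,
    real_inner_comm]
  congr 1
  push_cast
  ring

lemma Matrix.PosSemidef.exists_eq_conjTranspose_mul_self {p : ℕ} {S : Matrix (Fin p) (Fin p) ℝ}
    (hS : S.PosSemidef) : ∃ R : Matrix (Fin p) (Fin p) ℝ, S = R.conjTranspose * R := by
  open scoped MatrixOrder in
  exact ⟨CFC.sqrt S, by
    rw [← Matrix.star_eq_conjTranspose, (CFC.sqrt_nonneg S).isSelfAdjoint.star_eq,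
      CFC.sqrt_mul_sqrt_self S hS.nonneg]⟩

lemma trace_mul_self_le {p : ℕ} (A : Matrix (Fin p) (Fin p) ℝ) : (A * A).trace ≤ ‖A‖ ^ 2 := by
  rw [← frobInner_self]
  simp only [frobInner, Matrix.trace, Matrix.diag, Matrix.mul_apply]
  have h : ∑ i, ∑ j, A j i * A j i = ∑ i, ∑ j, A i j * A i j := Finset.sum_comm
  have : ∑ i, ∑ j, A i j * A j i ≤ ∑ i, ∑ j, (A i j * A i j + A j i * A j i) / 2 :=
    Finset.sum_le_sum fun i _ => Finset.sum_le_sum fun j _ => by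
      nlinarith [sq_nonneg (A i j - A j i)]
  simp only [← Finset.sum_div, Finset.sum_add_distrib] at this
  linarith

lemma quadForm_toEuclideanLin {p : ℕ} (A R : Matrix (Fin p) (Fin p) ℝ)
    (g : EuclideanSpace ℝ (Fin p)) :
    quadForm A (Matrix.toEuclideanLin R.conjTranspose g) =
      quadForm (R * A * R.conjTranspose) g := by
  rw [quadForm_eq, quadForm_eq, Matrix.toEuclideanLin_conjTranspose_eq_adjoint,
    LinearMap.adjoint_inner_left, ← Matrix.toEuclideanLin_conjTranspose_eq_adjoint]
  simp [Matrix.toLpLin_apply, Matrix.mulVec_mulVec, mul_assoc]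

/-- The centred quadratic form `(x - ν)ᵀ A (x - ν) - tr(A S)` of a Gaussian vector is
sub-exponential, with a scale that is controlled by the Frobenius norm of `S A`. -/
lemma integral_exp_quadForm_multivariateGaussian {p : ℕ} (ν : EuclideanSpace ℝ (Fin p))
    {S A : Matrix (Fin p) (Fin p) ℝ} (hS : S.PosSemidef) (hA : A.IsSymm) {l κ : ℝ}
    (hκ : ‖S * A‖ ≤ κ) (hl : |l| * κ ≤ 1 / 4) :
    Integrable (fun x => Real.exp (l * (quadForm A (x - ν) - (A * S).trace)))
      (multivariateGaussian ν S) ∧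
    ∫ x, Real.exp (l * (quadForm A (x - ν) - (A * S).trace)) ∂multivariateGaussian ν S ≤
      Real.exp (4 * (l * κ) ^ 2) := by
  obtain ⟨R, rfl⟩ := hS.exists_eq_conjTranspose_mul_self
  have hκ0 : 0 ≤ κ := (norm_nonneg _).trans hκ
  have hc : Continuous fun x =>
      Real.exp (l * (quadForm A (x - ν) - (A * (R.conjTranspose * R)).trace)) := by
    have := continuous_quadForm A
    fun_prop
  have hR : Continuous (Matrix.toEuclideanLin R.conjTranspose) :=
    LinearMap.continuous_of_finiteDimensional _
  have htr : (A * (R.conjTranspose * R)).trace = (R * A * R.conjTranspose).trace := by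
    rw [← mul_assoc, Matrix.trace_mul_cycle]
  rw [multivariateGaussian_eq_map, integrable_map_measure hc.aestronglyMeasurable (by fun_prop),
    integral_map (by fun_prop) hc.aestronglyMeasurable]
  simp only [Function.comp_def, add_sub_cancel_left, quadForm_toEuclideanLin, htr]
  have hH : (R * A * R.conjTranspose).IsHermitian :=
    Matrix.isHermitian_mul_mul_conjTranspose R (by
      rwa [Matrix.IsHermitian, Matrix.conjTranspose_eq_transpose_of_trivial])
  refine integral_exp_quadForm_stdGaussian hH ?_ hl hκ0
  calc _ = ((R.conjTranspose * R * A) * (R.conjTranspose * R * A)).trace := by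
        rw [← mul_assoc, Matrix.trace_mul_comm]
        simp only [mul_assoc]
    _ ≤ _ := (trace_mul_self_le _).trans (by gcongr)

/-! ### Sums over independent observations -/

/-- Chernoff bound for a sum of `N` sub-exponential variables of scale `κ`. -/
lemma measureReal_le_abs_le_of_subexponential {Ω : Type*} [MeasurableSpace Ω] {μ : Measure Ω}
    [IsProbabilityMeasure μ] {Y : Ω → ℝ} {κ N t : ℝ} (hκ : 0 < κ) (hN : 0 ≤ N) (ht : 0 ≤ t)
    (hY : ∀ l, |l| * κ ≤ 1 / 4 → Integrable (fun ω => Real.exp (l * Y ω)) μ ∧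
      ∫ ω, Real.exp (l * Y ω) ∂μ ≤ Real.exp (N * (4 * (l * κ) ^ 2))) :
    μ.real {ω | N * t * κ ≤ |Y ω|} ≤ 2 * Real.exp (-(N * t * min t 1 / 16)) := by
  set l := min t 1 / (8 * κ) with hl
  have hm0 : 0 ≤ min t 1 := le_min ht zero_le_one
  have hl0 : 0 ≤ l := by positivity
  have hlκ : l * κ = min t 1 / 8 := by rw [hl]; field_simp
  have hl4 : |l| * κ ≤ 1 / 4 := by
    rw [abs_of_nonneg hl0, hlκ]; linarith [min_le_right t 1]
  have hexp : Real.exp (-l * (N * t * κ)) * Real.exp (N * (4 * (l * κ) ^ 2)) ≤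
      Real.exp (-(N * t * min t 1 / 16)) := by
    rw [← Real.exp_add]
    refine Real.exp_le_exp.mpr ?_
    have e : -l * (N * t * κ) = -(N * t * (l * κ)) := by ring
    rw [e, hlκ]
    have : N * (min t 1 * min t 1) ≤ N * (min t 1 * t) :=
      mul_le_mul_of_nonneg_left (mul_le_mul_of_nonneg_left (min_le_left _ _) hm0) hN
    linarith
  have h1 : μ.real {ω | N * t * κ ≤ Y ω} ≤ Real.exp (-(N * t * min t 1 / 16)) := by
    refine (measure_ge_le_exp_mul_mgf _ hl0 (hY l hl4).1).trans (le_trans ?_ hexp)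
    exact mul_le_mul_of_nonneg_left (hY l hl4).2 (Real.exp_pos _).le
  have h2 : μ.real {ω | N * t * κ ≤ -Y ω} ≤ Real.exp (-(N * t * min t 1 / 16)) := by
    have hneg : |-l| * κ ≤ 1 / 4 := by rwa [abs_neg]
    have h := hY (-l) hneg
    simp only [neg_mul, neg_sq] at h
    have := measure_ge_le_exp_mul_mgf (X := fun ω => -Y ω) (N * t * κ) hl0
      (by simpa using h.1)
    refine this.trans (le_trans ?_ hexp)
    refine mul_le_mul_of_nonneg_left ?_ (Real.exp_pos _).le
    simpa [mgf] using h.2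
  calc _ ≤ μ.real ({ω | N * t * κ ≤ Y ω} ∪ {ω | N * t * κ ≤ -Y ω}) :=
        measureReal_mono fun ω hω => by
          simpa [le_abs] using hω
    _ ≤ _ := (measureReal_union_le _ _).trans (by linarith)

instance {n p : ℕ} (ν : EuclideanSpace ℝ (Fin p)) (S : Matrix (Fin p) (Fin p) ℝ) :
    IsProbabilityMeasure (gaussianSample n ν S) := by
  unfold gaussianSample; infer_instance

lemma integral_exp_sum_quadForm_gaussianSample {n p : ℕ} (ν : EuclideanSpace ℝ (Fin p))
    {S A : Matrix (Fin p) (Fin p) ℝ} (hS : S.PosSemidef) (hA : A.IsSymm) (I : Finset (Fin n))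
    {l κ : ℝ} (hκ : ‖S * A‖ ≤ κ) (hl : |l| * κ ≤ 1 / 4) :
    Integrable (fun X => Real.exp (l * ∑ k ∈ I, (quadForm A (X k - ν) - (A * S).trace)))
      (gaussianSample n ν S) ∧
    ∫ X, Real.exp (l * ∑ k ∈ I, (quadForm A (X k - ν) - (A * S).trace)) ∂gaussianSample n ν S ≤
      Real.exp (I.card * (4 * (l * κ) ^ 2)) := by
  classical
  obtain ⟨h1, h2⟩ := integral_exp_quadForm_multivariateGaussian ν hS hA hκ hl
  set f : Fin n → EuclideanSpace ℝ (Fin p) → ℝ := fun k x =>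
    if k ∈ I then Real.exp (l * (quadForm A (x - ν) - (A * S).trace)) else 1 with hf
  have hprod (X : Sample n p) :
      Real.exp (l * ∑ k ∈ I, (quadForm A (X k - ν) - (A * S).trace)) = ∏ k, f k (X k) := by
    rw [Finset.mul_sum, Real.exp_sum, ← Finset.prod_filter]
    simp
  simp only [hprod]
  refine ⟨Integrable.fintype_prod fun k => ?_, ?_⟩
  · by_cases hk : k ∈ I <;> simp [hf, hk, h1]
  · rw [gaussianSample, integral_fintype_prod_eq_prod (f := f)]
    have : ∀ k, ∫ x, f k x ∂multivariateGaussian ν S =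
        if k ∈ I then ∫ x, Real.exp (l * (quadForm A (x - ν) - (A * S).trace))
          ∂multivariateGaussian ν S else 1 := fun k => by
      by_cases hk : k ∈ I <;> simp [hf, hk]
    simp only [this]
    rw [← Finset.prod_filter]
    simp only [Finset.filter_mem_eq_inter, Finset.univ_inter, Finset.prod_const]
    rw [Real.exp_nat_mul]
    gcongr

/-- The sum over `I` of the observations centred at `ν`, normalized by `1 / √|I|`, so that it has the
same covariance as a single observation. -/
def normalizedSum {n p : ℕ} (I : Finset (Fin n)) (ν : EuclideanSpace ℝ (Fin p)) (X : Sample n p) :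
    EuclideanSpace ℝ (Fin p) := (√(I.card : ℝ))⁻¹ • ∑ k ∈ I, (X k - ν)

/-- Stability of the Gaussian law under normalized sums, by characteristic functions. -/
lemma map_normalizedSum {n p : ℕ} (ν : EuclideanSpace ℝ (Fin p))
    {S : Matrix (Fin p) (Fin p) ℝ} (hS : S.PosSemidef) {I : Finset (Fin n)} (hI : I.Nonempty) :
    (gaussianSample n ν S).map (normalizedSum I ν) = multivariateGaussian 0 S := by
  classical
  have hm : Measurable (normalizedSum (p := p) I ν) := by unfold normalizedSum; fun_prop
  apply Measure.ext_of_charFun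
  ext t
  rw [charFun_apply, integral_map hm.aemeasurable (by fun_prop), charFun_multivariateGaussian hS]
  set c : ℝ := (√(I.card : ℝ))⁻¹ with hc
  set f : Fin n → EuclideanSpace ℝ (Fin p) → ℂ := fun k x =>
    if k ∈ I then Complex.exp (inner ℝ x (c • t) * Complex.I) *
      Complex.exp (-(inner ℝ ν (c • t) * Complex.I)) else 1 with hf
  have hprod (X : Sample n p) :
      Complex.exp (inner ℝ (normalizedSum I ν X) t * Complex.I) = ∏ k, f k (X k) := by
    simp only [hf]
    rw [← Finset.prod_filter]
    simp only [Finset.filter_mem_eq_inter, Finset.univ_inter, ← Complex.exp_add]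
    rw [← Complex.exp_sum]
    simp only [normalizedSum, real_inner_smul_left, sum_inner, inner_sub_left,
      real_inner_smul_right, ← hc]
    congr 1
    push_cast
    rw [Finset.mul_sum, Finset.sum_mul]
    exact Finset.sum_congr rfl fun k _ => by ring
  simp only [hprod]
  rw [gaussianSample, integral_fintype_prod_eq_prod (f := f)]
  have hk : ∀ k, ∫ x, f k x ∂multivariateGaussian ν S =
      if k ∈ I then Complex.exp (-((I.card : ℂ)⁻¹ * ((t : Fin p → ℝ) ⬝ᵥ S.mulVec t : ℝ) / 2))
        else 1 := fun k => by
    by_cases hk : k ∈ I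
    · simp only [hf, hk, if_true]
      rw [integral_mul_const, ← charFun_apply, charFun_multivariateGaussian hS,
        ← Complex.exp_add]
      congr 1
      have hcc : c * c = (I.card : ℝ)⁻¹ := by
        rw [hc, ← mul_inv, Real.mul_self_sqrt (by positivity)]
      have : (((c • t : EuclideanSpace ℝ (Fin p)) : Fin p → ℝ) ⬝ᵥ
          S.mulVec (c • t : EuclideanSpace ℝ (Fin p))) =
          (I.card : ℝ)⁻¹ * ((t : Fin p → ℝ) ⬝ᵥ S.mulVec t) := by
        simp [Matrix.mulVec_smul, ← mul_assoc, hcc]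
      rw [this, real_inner_comm]
      push_cast
      ring
    · simp [hf, hk]
  simp only [hk]
  rw [← Finset.prod_filter]
  simp only [Finset.filter_mem_eq_inter, Finset.univ_inter, Finset.prod_const]
  rw [← Complex.exp_nat_mul]
  congr 1
  have : (I.card : ℂ) ≠ 0 := by simpa using hI.card_pos.ne'
  simp
  field_simp

/-! ### Linear functionals of the error of a sample covariance matrix -/

/-- The sample covariance is the second moment about the true mean, minus a rank-one term that comes
from centring at the sample mean. -/
lemma sampleCov_apply_eq {n p : ℕ} {I : Finset (Fin n)} (hI : I.Nonempty)
    (ν : EuclideanSpace ℝ (Fin p)) (X : Sample n p) (a b : Fin p) :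
    sampleCov I X a b = (I.card : ℝ)⁻¹ * ∑ k ∈ I, (X k a - ν a) * (X k b - ν b) -
      (I.card : ℝ)⁻¹ * (normalizedSum I ν X a * normalizedSum I ν X b) := by
  have hm : (I.card : ℝ) ≠ 0 := by simpa using hI.card_pos.ne'
  have hc : (√(I.card : ℝ))⁻¹ * (√(I.card : ℝ))⁻¹ = (I.card : ℝ)⁻¹ := by
    rw [← mul_inv, Real.mul_self_sqrt (by positivity)]
  have hn (a : Fin p) : normalizedSum I ν X a = (√(I.card : ℝ))⁻¹ * ∑ k ∈ I, (X k a - ν a) := by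
    simp [normalizedSum]
  have hmean (a : Fin p) :
      sampleMean I X a = ν a + (I.card : ℝ)⁻¹ * ∑ k ∈ I, (X k a - ν a) := by
    simp only [sampleMean, Finset.sum_sub_distrib, Finset.sum_const, nsmul_eq_mul, mul_sub]
    field_simp
    ring
  simp only [sampleCov, Matrix.of_apply, hn, hmean]
  set u := ∑ k ∈ I, (X k a - ν a) with hu
  set v := ∑ k ∈ I, (X k b - ν b) with hv
  have : ∑ k ∈ I, (X k a - (ν a + (I.card : ℝ)⁻¹ * u)) * (X k b - (ν b + (I.card : ℝ)⁻¹ * v)) =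
      ∑ k ∈ I, (X k a - ν a) * (X k b - ν b) - (I.card : ℝ)⁻¹ * v * u -
        (I.card : ℝ)⁻¹ * u * v + I.card * ((I.card : ℝ)⁻¹ * u * ((I.card : ℝ)⁻¹ * v)) := by
    have e (k : Fin n) :
        (X k a - (ν a + (I.card : ℝ)⁻¹ * u)) * (X k b - (ν b + (I.card : ℝ)⁻¹ * v)) =
        (X k a - ν a) * (X k b - ν b) - (I.card : ℝ)⁻¹ * v * (X k a - ν a) -
          (I.card : ℝ)⁻¹ * u * (X k b - ν b) + (I.card : ℝ)⁻¹ * u * ((I.card : ℝ)⁻¹ * v) := by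
      ring
    rw [Finset.sum_congr rfl fun k _ => e k, Finset.sum_add_distrib, Finset.sum_sub_distrib,
      Finset.sum_sub_distrib, ← Finset.mul_sum, ← Finset.mul_sum, ← hu, ← hv, Finset.sum_const,
      nsmul_eq_mul]
  rw [this]
  have h2 : (√(I.card : ℝ))⁻¹ * u * ((√(I.card : ℝ))⁻¹ * v) = (I.card : ℝ)⁻¹ * u * v := by
    rw [← hc]; ring
  rw [h2]
  field_simp
  ring

lemma frobInner_sampleCov_sub {n p : ℕ} {I : Finset (Fin n)} (hI : I.Nonempty)
    (ν : EuclideanSpace ℝ (Fin p)) (A S : Matrix (Fin p) (Fin p) ℝ) (hA : A.IsSymm)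
    (X : Sample n p) :
    frobInner A (sampleCov I X - S) =
      (I.card : ℝ)⁻¹ * (∑ k ∈ I, (quadForm A (X k - ν) - (A * S).trace) -
        (quadForm A (normalizedSum I ν X) - (A * S).trace) - (A * S).trace) := by
  have hm : (I.card : ℝ) ≠ 0 := by simpa using hI.card_pos.ne'
  have h1 : frobInner A (sampleCov I X - S) =
      (I.card : ℝ)⁻¹ * ∑ k ∈ I, quadForm A (X k - ν) -
        (I.card : ℝ)⁻¹ * quadForm A (normalizedSum I ν X) - frobInner A S := by
    have e (a b : Fin p) : sampleCov I X a b =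
        (I.card : ℝ)⁻¹ * ∑ k ∈ I, (X k - ν) a * (X k - ν) b -
          (I.card : ℝ)⁻¹ * (normalizedSum I ν X a * normalizedSum I ν X b) :=
      sampleCov_apply_eq hI ν X a b
    simp only [frobInner, quadForm, Matrix.sub_apply, e, mul_sub, Finset.sum_sub_distrib]
    congr 2
    · simp only [Finset.mul_sum]
      symm
      rw [Finset.sum_comm]
      refine Finset.sum_congr rfl fun a _ => ?_
      rw [Finset.sum_comm]
      exact Finset.sum_congr rfl fun b _ => Finset.sum_congr rfl fun k _ => by ring
    · simp only [Finset.mul_sum]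
      exact Finset.sum_congr rfl fun a _ => Finset.sum_congr rfl fun b _ => by ring
  rw [h1, frobInner_eq_trace A S hA, Finset.sum_sub_distrib]
  simp only [Finset.sum_const, nsmul_eq_mul]
  field_simp
  ring

lemma measurable_normalizedSum {n p : ℕ} (I : Finset (Fin n)) (ν : EuclideanSpace ℝ (Fin p)) :
    Measurable (normalizedSum I ν : Sample n p → _) := by
  unfold normalizedSum; fun_prop

/-- Exponential tail bound for a linear functional of the error of a sample covariance matrix. The
summand `b / m` accounts for the bias of the `1/m`-normalization. -/
theorem measureReal_frobInner_sampleCov_le {n p : ℕ} (ν : EuclideanSpace ℝ (Fin p))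
    {S A : Matrix (Fin p) (Fin p) ℝ} (hS : S.PosSemidef) (hA : A.IsSymm) {I : Finset (Fin n)}
    (hI : I.Nonempty) {κ b t : ℝ} (hκ0 : 0 < κ) (hκ : ‖S * A‖ ≤ κ) (hb : |frobInner A S| ≤ b)
    (ht : 0 < t) :
    (gaussianSample n ν S).real
      {X | 2 * t * κ + b / I.card < |frobInner A (sampleCov I X - S)|} ≤
      4 * Real.exp (-(I.card * t * min t 1 / 16)) := by
  have hm1 : (1 : ℝ) ≤ I.card := by exact_mod_cast hI.card_pos
  have hm0 : (0 : ℝ) < I.card := by linarith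
  set μ := gaussianSample n ν S
  have h1 := measureReal_le_abs_le_of_subexponential (μ := μ)
    (Y := fun X => ∑ k ∈ I, (quadForm A (X k - ν) - (A * S).trace)) hκ0 hm0.le ht.le
    fun l hl => integral_exp_sum_quadForm_gaussianSample ν hS hA I hκ hl
  have hq := (continuous_quadForm A).measurable
  have h2 := measureReal_le_abs_le_of_subexponential (μ := μ) (N := 1) (t := I.card * t)
    (Y := fun X => quadForm A (normalizedSum I ν X) - (A * S).trace) hκ0 zero_le_one
    (by positivity) fun l hl => by
      have hmeas : Measurable fun x => Real.exp (l * (quadForm A x - (A * S).trace)) := by fun_prop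
      have := integral_exp_quadForm_multivariateGaussian 0 hS hA hκ hl
      simp only [sub_zero] at this
      rw [← map_normalizedSum ν hS hI, integrable_map_measure hmeas.aestronglyMeasurable
        (measurable_normalizedSum I ν).aemeasurable, integral_map
        (measurable_normalizedSum I ν).aemeasurable hmeas.aestronglyMeasurable] at this
      rw [one_mul]
      exact this
  have h3 : Real.exp (-(1 * (I.card * t) * min (I.card * t) 1 / 16)) ≤
      Real.exp (-(I.card * t * min t 1 / 16)) := by
    -- the sample mean contributes a single quadratic form, with a tail at least as light
    refine Real.exp_le_exp.mpr ?_
    have : min t 1 ≤ min (I.card * t) 1 :=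
      min_le_min_right _ (le_mul_of_one_le_left ht.le hm1)
    have := mul_le_mul_of_nonneg_left this (mul_pos hm0 ht).le
    linarith
  calc _ ≤ μ.real ({X | I.card * t * κ ≤ |∑ k ∈ I, (quadForm A (X k - ν) - (A * S).trace)|} ∪
        {X | 1 * (I.card * t) * κ ≤ |quadForm A (normalizedSum I ν X) - (A * S).trace|}) := by
        refine measureReal_mono fun X hX => ?_
        simp only [Set.mem_ofPred_eq, Set.mem_union] at hX ⊢
        by_contra! hcon
        rw [frobInner_sampleCov_sub hI ν A S hA, abs_mul, abs_inv, abs_of_pos hm0] at hX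
        rw [frobInner_eq_trace A S hA] at hb
        refine absurd hX (not_lt.mpr ?_)
        rw [inv_mul_le_iff₀ hm0]
        have e : (I.card : ℝ) * (2 * t * κ + b / I.card) =
            I.card * t * κ + 1 * (I.card * t) * κ + b := by field_simp; ring
        rw [e]
        exact (abs_sub _ _).trans (add_le_add ((abs_sub _ _).trans
          (add_le_add hcon.1.le hcon.2.le)) hb)
    _ ≤ _ := (measureReal_union_le _ _).trans (by linarith)

/-! ### Frobenius geometry and the sparse class -/

/-- Schur test in the Frobenius norm: if the absolute row sums of the symmetric matrix `S` are at
most `κ`, then multiplication by `S` has norm at most `κ`. -/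
lemma norm_mul_le_of_rowSum_le {p : ℕ} {S : Matrix (Fin p) (Fin p) ℝ} (hS : S.IsSymm) {κ : ℝ}
    (hκ0 : 0 ≤ κ) (hκ : ∀ i, ∑ j, |S i j| ≤ κ) (A : Matrix (Fin p) (Fin p) ℝ) :
    ‖S * A‖ ≤ κ * ‖A‖ := by
  refine abs_le_of_sq_le_sq' ?_ (by positivity) |>.2
  rw [mul_pow, ← frobInner_self, ← frobInner_self]
  have h (i b : Fin p) : (S * A) i b * (S * A) i b ≤ κ * ∑ j, |S i j| * A j b ^ 2 := by
    have hcs := Finset.sum_mul_sq_le_sq_mul_sq Finset.univ (fun j => √|S i j|)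
      (fun j => √|S i j| * |A j b|)
    simp only [mul_pow, Real.sq_sqrt (abs_nonneg _), ← mul_assoc, sq_abs,
      Real.mul_self_sqrt (abs_nonneg _)] at hcs
    have hle : |(S * A) i b| ≤ ∑ j, |S i j| * |A j b| := by
      rw [Matrix.mul_apply]
      exact (Finset.abs_sum_le_sum_abs _ _).trans_eq
        (Finset.sum_congr rfl fun j _ => abs_mul _ _)
    calc (S * A) i b * (S * A) i b = |(S * A) i b| ^ 2 := by rw [sq_abs, sq]
      _ ≤ (∑ j, |S i j| * |A j b|) ^ 2 := by gcongr
      _ ≤ _ := hcs.trans (mul_le_mul_of_nonneg_right (hκ i)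
        (Finset.sum_nonneg fun j _ => by positivity))
  calc frobInner (S * A) (S * A) ≤ ∑ i, ∑ b, κ * ∑ j, |S i j| * A j b ^ 2 :=
        Finset.sum_le_sum fun i _ => Finset.sum_le_sum fun b _ => h i b
    _ = κ * ∑ j, (∑ i, |S j i|) * ∑ b, A j b ^ 2 := by
        simp only [← Finset.mul_sum]
        congr 1
        have h (i : Fin p) : ∑ b, ∑ j, |S i j| * A j b ^ 2 = ∑ j, |S j i| * ∑ b, A j b ^ 2 := by
          rw [Finset.sum_comm]
          simp only [Finset.mul_sum, hS.apply]
        simp only [h]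
        rw [Finset.sum_comm]
        simp only [Finset.sum_mul]
    _ ≤ κ * ∑ j, κ * ∑ b, A j b ^ 2 := by
        refine mul_le_mul_of_nonneg_left (Finset.sum_le_sum fun j _ => ?_) hκ0
        exact mul_le_mul_of_nonneg_right (hκ j) (Finset.sum_nonneg fun b _ => sq_nonneg _)
    _ = κ ^ 2 * frobInner A A := by
        simp only [frobInner, ← Finset.mul_sum, ← mul_assoc, ← sq]

lemma abs_frobInner_le {p : ℕ} (A B : Matrix (Fin p) (Fin p) ℝ) :
    |frobInner A B| ≤ ‖A‖ * ‖B‖ := by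
  refine abs_le_of_sq_le_sq ?_ (by positivity)
  rw [mul_pow, ← frobInner_self, ← frobInner_self]
  simp only [frobInner, ← Finset.sum_product', ← sq]
  exact Finset.sum_mul_sq_le_sq_mul_sq _ _ _

lemma norm_sub_sq_eq {p : ℕ} (A B S : Matrix (Fin p) (Fin p) ℝ) :
    ‖A - B‖ ^ 2 = ‖A - S‖ ^ 2 - 2 * frobInner (A - S) (B - S) + ‖B - S‖ ^ 2 := by
  simp only [← frobInner_self, frobInner, Finset.mul_sum, ← Finset.sum_sub_distrib,
    ← Finset.sum_add_distrib, Matrix.sub_apply]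
  exact Finset.sum_congr rfl fun a _ => Finset.sum_congr rfl fun b _ => by ring

lemma Matrix.PosSemidef.isSymm_real {p : ℕ} {S : Matrix (Fin p) (Fin p) ℝ} (hS : S.PosSemidef) :
    S.IsSymm := by
  have := hS.isHermitian
  rwa [Matrix.IsHermitian, Matrix.conjTranspose_eq_transpose_of_trivial] at this

/-- Entries of a positive semidefinite matrix are bounded by the largest diagonal entry. -/
lemma Matrix.PosSemidef.abs_apply_le {p : ℕ} {S : Matrix (Fin p) (Fin p) ℝ} (hS : S.PosSemidef)
    {M : ℝ} (hM : ∀ i, S i i ≤ M) (i j : Fin p) : |S i j| ≤ M := by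
  obtain ⟨R, hR⟩ := hS.exists_eq_conjTranspose_mul_self
  have hd (i j : Fin p) : S i j = ∑ k, R k i * R k j := by
    rw [hR, Matrix.mul_apply]; simp
  have hi := hM i
  have hj := hM j
  rw [hd] at hi hj
  rw [hd]
  have h1 : ∑ k, |R k i * R k j| ≤ ∑ k, (R k i * R k i + R k j * R k j) / 2 :=
    Finset.sum_le_sum fun k _ => abs_le.mpr
      ⟨by nlinarith [sq_nonneg (R k i + R k j)], by nlinarith [sq_nonneg (R k i - R k j)]⟩
  rw [← Finset.sum_div, Finset.sum_add_distrib] at h1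
  have := Finset.abs_sum_le_sum_abs (fun k => R k i * R k j) Finset.univ
  linarith

lemma absPow_nonneg (q x : ℝ) : 0 ≤ absPow q x := by
  unfold absPow; split_ifs <;> positivity

/-- Powers of an entry of size at most `a` are controlled by its `q`-th power. -/
lemma abs_rpow_le_mul_absPow {q r a x : ℝ} (hqr : q ≤ r) (hr : 0 < r) (hx : |x| ≤ a) :
    |x| ^ r ≤ a ^ (r - q) * absPow q x := by
  unfold absPow
  split_ifs with h
  · simp [h, Real.zero_rpow hr.ne']
  · have hx0 : 0 < |x| := abs_pos.mpr h
    calc |x| ^ r = |x| ^ (r - q) * |x| ^ q := by rw [← Real.rpow_add hx0]; ring_nf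
      _ ≤ _ := by
        gcongr

section SparseClass

variable {p : ℕ} {q c M : ℝ} {S : Matrix (Fin p) (Fin p) ℝ}

lemma rowSum_abs_le_of_mem_sparseClass (hq1 : q < 1) (hS : S ∈ sparseClass p q c M) (i : Fin p) :
    ∑ j, |S i j| ≤ M ^ (1 - q) * c := by
  have hM : 0 ≤ M := (hS.1.diag_nonneg (i := i)).trans (hS.2.1 i)
  calc ∑ j, |S i j| ≤ ∑ j, M ^ (1 - q) * absPow q (S i j) := Finset.sum_le_sum fun j _ => by
        simpa using abs_rpow_le_mul_absPow hq1.le one_pos (hS.1.abs_apply_le hS.2.1 i j)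
    _ ≤ _ := by
        rw [← Finset.mul_sum]
        exact mul_le_mul_of_nonneg_left (hS.2.2 i) (by positivity)

lemma norm_sq_le_of_mem_sparseClass (hq1 : q < 1) (hS : S ∈ sparseClass p q c M) :
    ‖S‖ ^ 2 ≤ p * (M ^ (2 - q) * c) := by
  rw [← frobInner_self]
  calc frobInner S S ≤ ∑ _i : Fin p, M ^ (2 - q) * c := Finset.sum_le_sum fun i _ => by
        have hM : 0 ≤ M := (hS.1.diag_nonneg (i := i)).trans (hS.2.1 i)
        calc ∑ j, S i j * S i j ≤ ∑ j, M ^ (2 - q) * absPow q (S i j) :=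
              Finset.sum_le_sum fun j _ => by
                have := abs_rpow_le_mul_absPow (q := q) (r := 2) (by linarith) two_pos
                  (hS.1.abs_apply_le hS.2.1 i j)
                simpa [sq] using this
          _ ≤ _ := by
              rw [← Finset.mul_sum]
              exact mul_le_mul_of_nonneg_left (hS.2.2 i) (by positivity)
    _ = _ := by simp

/-- Entrywise risk of hard thresholding: if `x` estimates `σ` up to `s / 2`, then thresholding `x`
at `s` gives an error that is at most of the order of the truncated `q`-sparse size of `σ`. -/
lemma sq_threshold_sub_le {s x σ : ℝ} (hq0 : 0 ≤ q) (hq1 : q < 1) (hs : 0 < s)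
    (hx : |x - σ| ≤ s / 2) :
    ((if s ≤ |x| then x else 0) - σ) ^ 2 ≤ 9 / 4 * s ^ (2 - q) * absPow q σ := by
  split_ifs with h
  · have hσ : s / 2 ≤ |σ| := by
      have := abs_sub_abs_le_abs_sub x σ
      linarith
    have hσ0 : σ ≠ 0 := fun h0 => by rw [h0, abs_zero] at hσ; linarith
    have h1 : (x - σ) ^ 2 ≤ (s / 2) ^ 2 :=
      sq_le_sq' (by linarith [(abs_le.mp hx).1]) (abs_le.mp hx).2
    -- `s² = s^(2-q) s^q ≤ s^(2-q) (2|σ|)^q ≤ 2 s^(2-q) |σ|^q`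
    have h2 : s ^ q ≤ 2 * |σ| ^ q := by
      calc s ^ q ≤ (2 * |σ|) ^ q := by gcongr; linarith
        _ = 2 ^ q * |σ| ^ q := Real.mul_rpow (by norm_num) (abs_nonneg _)
        _ ≤ 2 * |σ| ^ q := by
          gcongr
          simpa using Real.rpow_le_rpow_of_exponent_le (x := 2) (by norm_num) hq1.le
    have h3 : s ^ 2 = s ^ (2 - q) * s ^ q := by
      rw [← Real.rpow_add hs, ← Real.rpow_two]; ring_nf
    have h4 : s ^ (2 - q) * s ^ q ≤ s ^ (2 - q) * (2 * |σ| ^ q) := by gcongr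
    have h5 : 0 ≤ s ^ (2 - q) * |σ| ^ q := by positivity
    simp only [absPow, hσ0, if_false]
    nlinarith
  · have hσ : |σ| ≤ 3 / 2 * s := by
      have := abs_sub_abs_le_abs_sub σ x
      rw [abs_sub_comm] at this
      linarith
    have h1 := abs_rpow_le_mul_absPow (q := q) (r := 2) (by linarith) two_pos hσ
    have h2 : (3 / 2 * s) ^ (2 - q) ≤ 9 / 4 * s ^ (2 - q) := by
      rw [Real.mul_rpow (by norm_num) hs.le]
      gcongr
      calc (3 / 2 : ℝ) ^ (2 - q) ≤ (3 / 2) ^ (2 : ℝ) :=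
            Real.rpow_le_rpow_of_exponent_le (by norm_num) (by linarith)
        _ = 9 / 4 := by norm_num
    calc (0 - σ) ^ 2 = |σ| ^ (2 : ℝ) := by simp
      _ ≤ _ := h1.trans (mul_le_mul_of_nonneg_right h2 (absPow_nonneg _ _))

/-- Risk of hard thresholding over the sparse class, on the event of uniform entrywise accuracy. -/
lemma norm_hardThreshold_sub_sq_le (hq0 : 0 ≤ q) (hq1 : q < 1) (hS : S ∈ sparseClass p q c M)
    {s : ℝ} (hs : 0 < s) {A : Matrix (Fin p) (Fin p) ℝ} (hA : ∀ i j, |A i j - S i j| ≤ s / 2) :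
    ‖hardThreshold s A - S‖ ^ 2 ≤ 9 / 4 * s ^ (2 - q) * (p * c) := by
  rw [← frobInner_self]
  calc _ ≤ ∑ _i : Fin p, 9 / 4 * s ^ (2 - q) * c := Finset.sum_le_sum fun i _ => by
        calc _ ≤ ∑ j, 9 / 4 * s ^ (2 - q) * absPow q (S i j) := Finset.sum_le_sum fun j _ => by
              simpa [hardThreshold, sq] using sq_threshold_sub_le hq0 hq1 hs (hA i j)
          _ ≤ _ := by
              rw [← Finset.mul_sum]
              exact mul_le_mul_of_nonneg_left (hS.2.2 i) (by positivity)
    _ = _ := by simp; ring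

end SparseClass

/-! ### Concentration over the grid and over the entries -/

/-- Replacing the coordinates in `I` of a product-distributed family by those of an independent copy
does not change the law. -/
lemma measurePreserving_piecewise {ι E : Type*} [Fintype ι] [DecidableEq ι] [MeasurableSpace E]
    (μ : Measure E) [IsProbabilityMeasure μ] (I : Finset ι) :
    MeasurePreserving (fun z : (ι → E) × (ι → E) => I.piecewise z.2 z.1)
      ((Measure.pi fun _ => μ).prod (Measure.pi fun _ => μ)) (Measure.pi fun _ => μ) := by
  have hm : Measurable fun z : (ι → E) × (ι → E) => I.piecewise z.2 z.1 := by
    refine measurable_pi_lambda _ fun k => ?_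
    by_cases hk : k ∈ I <;> simp only [Finset.piecewise, hk, if_true, if_false] <;> fun_prop
  refine ⟨hm, (Measure.pi_eq fun s hs => ?_).symm⟩
  rw [Measure.map_apply hm (MeasurableSet.univ_pi hs)]
  have : (fun z : (ι → E) × (ι → E) => I.piecewise z.2 z.1) ⁻¹' Set.univ.pi s =
      (Set.univ.pi fun k => if k ∈ I then Set.univ else s k) ×ˢ
        (Set.univ.pi fun k => if k ∈ I then s k else Set.univ) := by
    ext z
    simp only [Set.mem_preimage, Set.mem_pi, Set.mem_univ, true_imp_iff, Set.mem_prod,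
      ← forall_and]
    refine forall_congr' fun k => ?_
    by_cases hk : k ∈ I <;> simp [hk]
  rw [this, Measure.prod_prod, Measure.pi_pi, Measure.pi_pi, ← Finset.prod_mul_distrib]
  refine Finset.prod_congr rfl fun k _ => ?_
  by_cases hk : k ∈ I <;> simp [hk]

/-- Conditioning on the coordinates outside `I`: a bound on the conditional probability of an event
is a bound on its probability. -/
lemma measure_pi_le_of_forall_piecewise {ι E : Type*} [Fintype ι] [DecidableEq ι]
    [MeasurableSpace E] (μ : Measure E) [IsProbabilityMeasure μ] (I : Finset ι) {s : Set (ι → E)}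
    (hs : MeasurableSet s) {η : ENNReal}
    (h : ∀ x, (Measure.pi fun _ => μ) {y | I.piecewise y x ∈ s} ≤ η) :
    (Measure.pi fun _ => μ) s ≤ η := by
  have hp := measurePreserving_piecewise μ I
  rw [← hp.measure_preimage hs.nullMeasurableSet, Measure.prod_apply (hp.measurable hs)]
  calc _ ≤ ∫⁻ _, η ∂(Measure.pi fun _ : ι => μ) := lintegral_mono fun x => h x
    _ = η := by simp

section Sample

variable {n p : ℕ}

lemma sampleCov_congr {I : Finset (Fin n)} {X Y : Sample n p} (h : ∀ k ∈ I, X k = Y k) :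
    sampleCov I X = sampleCov I Y := by
  have hm (a : Fin p) : sampleMean I X a = sampleMean I Y a := by
    simp only [sampleMean]
    rw [Finset.sum_congr rfl fun k hk => by rw [h k hk]]
  ext a b
  simp only [sampleCov, Matrix.of_apply, hm]
  rw [Finset.sum_congr rfl fun k hk => by rw [h k hk]]

lemma sampleCov_isSymm (I : Finset (Fin n)) (X : Sample n p) : (sampleCov I X).IsSymm :=
  Matrix.IsSymm.ext fun a b => by simp only [sampleCov, Matrix.of_apply, mul_comm]

lemma hardThreshold_isSymm {A : Matrix (Fin p) (Fin p) ℝ} (hA : A.IsSymm) (s : ℝ) :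
    (hardThreshold s A).IsSymm :=
  Matrix.IsSymm.ext fun a b => by simp only [hardThreshold, Matrix.of_apply, hA.apply a b]

lemma measurable_sampleCov_apply (I : Finset (Fin n)) (a b : Fin p) :
    Measurable fun X : Sample n p => sampleCov I X a b := by
  simp only [sampleCov, sampleMean, Matrix.of_apply]
  fun_prop

lemma measurable_hardThreshold_sampleCov_apply (I : Finset (Fin n)) (s : ℝ) (a b : Fin p) :
    Measurable fun X : Sample n p => hardThreshold s (sampleCov I X) a b := by
  have := measurable_sampleCov_apply I a b
  exact Measurable.ite (measurableSet_le measurable_const (by fun_prop)) this measurable_const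

lemma norm_eq_sqrt_frobInner (A : Matrix (Fin p) (Fin p) ℝ) : ‖A‖ = √(frobInner A A) := by
  rw [frobInner_self, Real.sqrt_sq (norm_nonneg _)]

lemma card_trainIndices {B : ℕ} :
    (Finset.univ.filter fun k : Fin n => (k : ℕ) + B < n).card = n - B := by
  rw [Finset.filter_congr fun k _ => (Nat.lt_sub_iff_add_lt (b := B)).symm,
    Fin.card_filter_val_lt, min_eq_right (Nat.sub_le _ _)]

lemma card_validIndices {B : ℕ} (hB : B ≤ n) :
    (Finset.univ.filter fun k : Fin n => n ≤ (k : ℕ) + B).card = B := by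
  have h := Finset.card_filter_add_card_filter_not (s := (Finset.univ : Finset (Fin n)))
    fun k : Fin n => (k : ℕ) + B < n
  rw [card_trainIndices] at h
  simp only [not_lt, Finset.card_univ, Fintype.card_fin] at h
  omega

/-- The event that the error of the validation covariance is nearly orthogonal, up to `τ`, to the
errors of all thresholded training covariances of the grid fails with small probability. -/
theorem measure_exists_frobInner_validCov_le {B J : ℕ} (hB0 : 0 < B) (hBn : B < n)
    (ν : EuclideanSpace ℝ (Fin p)) {S : Matrix (Fin p) (Fin p) ℝ} (hS : S.PosSemidef) {κ t : ℝ}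
    (hκ0 : 0 < κ) (hκ : ∀ i, ∑ j, |S i j| ≤ κ) (ht : 0 < t) (h : ℝ) :
    gaussianSample n ν S {X | ∃ i ≤ J, (2 * t * κ + ‖S‖ / B) *
        ‖hardThreshold (i * h) (trainCov B X) - S‖ <
          |frobInner (hardThreshold (i * h) (trainCov B X) - S) (validCov B X - S)|} ≤
      ENNReal.ofReal ((J + 1) * (4 * Real.exp (-(B * t * min t 1 / 16)))) := by
  classical
  set V : Finset (Fin n) := Finset.univ.filter fun k : Fin n => n ≤ (k : ℕ) + B with hV
  have hcard : V.card = B := card_validIndices hBn.le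
  have hVne : V.Nonempty := Finset.card_pos.mp (by omega)
  -- condition on the training part, that is, redraw only the validation part `V`
  refine measure_pi_le_of_forall_piecewise (multivariateGaussian ν S) V ?_ fun X => ?_
  · have hset : {X : Sample n p | ∃ i ≤ J, (2 * t * κ + ‖S‖ / B) *
        ‖hardThreshold (i * h) (trainCov B X) - S‖ <
          |frobInner (hardThreshold (i * h) (trainCov B X) - S) (validCov B X - S)|} =
        ⋃ i, ⋃ (_ : i ≤ J), {X | (2 * t * κ + ‖S‖ / B) *
          ‖hardThreshold (i * h) (trainCov B X) - S‖ <
            |frobInner (hardThreshold (i * h) (trainCov B X) - S) (validCov B X - S)|} := by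
      ext X
      simp
    rw [hset]
    refine MeasurableSet.iUnion fun i => MeasurableSet.iUnion fun _ => ?_
    have h1 (a b : Fin p) : Measurable fun X : Sample n p =>
        hardThreshold (i * h) (trainCov B X) a b :=
      measurable_hardThreshold_sampleCov_apply _ _ a b
    have h2 (a b : Fin p) : Measurable fun X : Sample n p => validCov B X a b :=
      measurable_sampleCov_apply _ a b
    refine measurableSet_lt ?_ ?_ <;>
      simp only [norm_eq_sqrt_frobInner (_ - S), frobInner, Matrix.sub_apply] <;> fun_prop
  · have htrain (Y : Sample n p) : trainCov B (V.piecewise Y X) = trainCov B X :=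
      sampleCov_congr fun k hk => by
        have : k ∉ V := by simp [hV] at hk ⊢; omega
        simp [this]
    have hvalid (Y : Sample n p) : validCov B (V.piecewise Y X) = sampleCov V Y :=
      sampleCov_congr fun k hk => by simp [show k ∈ V from hk]
    simp only [Set.mem_ofPred_eq, htrain, hvalid]
    change gaussianSample n ν S _ ≤ _
    rw [← ofReal_measureReal]
    refine ENNReal.ofReal_le_ofReal ?_
    calc _ ≤ (gaussianSample n ν S).real (⋃ i ∈ Finset.range (J + 1),
          {Y | (2 * t * κ + ‖S‖ / B) * ‖hardThreshold (i * h) (trainCov B X) - S‖ <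
            |frobInner (hardThreshold (i * h) (trainCov B X) - S) (sampleCov V Y - S)|}) :=
          by
            refine measureReal_mono ?_ (measure_ne_top _ _)
            rintro Y ⟨i, hi, hY⟩
            simp only [Set.mem_iUnion, Finset.mem_range]
            exact ⟨i, by omega, hY⟩
      _ ≤ ∑ i ∈ Finset.range (J + 1), 4 * Real.exp (-(B * t * min t 1 / 16)) := by
          refine (measureReal_biUnion_finset_le _ _).trans (Finset.sum_le_sum fun i _ => ?_)
          set A := hardThreshold (i * h) (trainCov B X) - S with hA
          have hAs : A.IsSymm :=
            (hardThreshold_isSymm (sampleCov_isSymm _ X) _).sub hS.isSymm_real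
          -- the tail bound needs a positive scale, so `A = 0` is treated separately
          rcases (norm_nonneg A).eq_or_lt with h0 | h0
          · have : {Y | (2 * t * κ + ‖S‖ / B) * ‖A‖ < |frobInner A (sampleCov V Y - S)|} = ∅ := by
              ext Y
              have := abs_frobInner_le A (sampleCov V Y - S)
              rw [← h0, zero_mul] at this
              simpa [← h0] using this
            rw [this, measureReal_empty]
            positivity
          · have := measureReal_frobInner_sampleCov_le ν hS hAs hVne (κ := κ * ‖A‖)
              (b := ‖A‖ * ‖S‖) (t := t) (by positivity)
              (norm_mul_le_of_rowSum_le hS.isSymm_real hκ0.le hκ A) (abs_frobInner_le A S) ht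
            rw [hcard] at this
            refine le_trans (le_of_eq ?_) this
            congr 1
            ext Y
            simp only [Set.mem_ofPred_eq]
            rw [show (2 * t * κ + ‖S‖ / B) * ‖A‖ = 2 * t * (κ * ‖A‖) + ‖A‖ * ‖S‖ / B by ring]
      _ = _ := by simp

/-- Uniform entrywise accuracy of a sample covariance matrix. -/
theorem measureReal_exists_abs_sampleCov_sub_le (ν : EuclideanSpace ℝ (Fin p))
    {S : Matrix (Fin p) (Fin p) ℝ} (hS : S.PosSemidef) {I : Finset (Fin n)} (hI : I.Nonempty)
    {κ M t : ℝ} (hκ0 : 0 < κ) (hκ : ∀ i, ∑ j, |S i j| ≤ κ) (hM : ∀ i, S i i ≤ M) (ht : 0 < t) :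
    (gaussianSample n ν S).real
        {X | ∃ i j, 2 * t * κ + M / I.card < |sampleCov I X i j - S i j|} ≤
      p ^ 2 * (4 * Real.exp (-(I.card * t * min t 1 / 16))) := by
  classical
  calc _ ≤ (gaussianSample n ν S).real (⋃ z ∈ (Finset.univ : Finset (Fin p × Fin p)),
        {X | 2 * t * κ + M / I.card < |sampleCov I X z.1 z.2 - S z.1 z.2|}) :=
        by
          refine measureReal_mono ?_ (measure_ne_top _ _)
          rintro X ⟨i, j, hX⟩
          simp only [Set.mem_iUnion, Finset.mem_univ]
          exact ⟨(i, j), trivial, hX⟩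
    _ ≤ ∑ _z : Fin p × Fin p, 4 * Real.exp (-(I.card * t * min t 1 / 16)) := by
        refine (measureReal_biUnion_finset_le _ _).trans (Finset.sum_le_sum fun z _ => ?_)
        obtain ⟨i, j⟩ := z
        -- the symmetric test matrix with `⟨A, D⟩ = 2 D i j` for symmetric `D`
        set A : Matrix (Fin p) (Fin p) ℝ := Matrix.single i j 1 + Matrix.single j i 1 with hA
        have hAs : A.IsSymm := by
          rw [hA, Matrix.IsSymm, Matrix.transpose_add, Matrix.transpose_single,
            Matrix.transpose_single, add_comm]
        have hinner (D : Matrix (Fin p) (Fin p) ℝ) (hD : D.IsSymm) :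
            frobInner A D = 2 * D i j := by
          have : D j i = D i j := hD.apply i j
          rw [frobInner_eq_trace A D hAs, hA, add_mul, Matrix.trace_add, Matrix.trace_single_mul,
            Matrix.trace_single_mul]
          simp [this, two_mul]
        have hsingle (i j : Fin p) : ‖(Matrix.single i j 1 : Matrix (Fin p) (Fin p) ℝ)‖ ≤ 1 := by
          refine (sq_le_one_iff₀ (norm_nonneg _)).mp ?_
          rw [← frobInner_self]
          simp [frobInner, Matrix.single_apply, ite_and]
        have hAn : ‖A‖ ≤ 2 := (norm_add_le _ _).trans (by linarith [hsingle i j, hsingle j i])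
        have h := measureReal_frobInner_sampleCov_le ν hS hAs hI (κ := κ * 2) (b := 2 * M)
          (t := t) (by positivity) ((norm_mul_le_of_rowSum_le hS.isSymm_real hκ0.le hκ A).trans
            (by gcongr)) (by
              rw [hinner S hS.isSymm_real, abs_mul, abs_two]
              linarith [hS.abs_apply_le hM i j]) ht
        refine le_trans (le_of_eq ?_) h
        congr 1
        ext X
        simp only [Set.mem_ofPred_eq]
        rw [hinner _ ((sampleCov_isSymm I X).sub hS.isSymm_real), abs_mul, abs_two,
          Matrix.sub_apply, show 2 * t * (κ * 2) + 2 * M / I.card = 2 * (2 * t * κ + M / I.card) by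
            ring]
        exact (mul_lt_mul_iff_right₀ two_pos).symm
    _ = _ := by simp [sq]

end Sample

/-! ### From comparison of losses to stochastic orders -/

section InProbability

variable {Ω : ℕ → Type} [∀ n, MeasurableSpace (Ω n)] {P : ∀ n, Measure (Ω n)}
  {a b : ∀ n, Ω n → ℝ} {r : ℕ → ℝ}

/-- If `b² = Ω_P(r)` and `b ≤ a ≤ b + o_P(√r)`, then `a = b (1 + o_P(1))`. -/
lemma IsExactOrderInProb.isEquivalentInProb (hb : ∀ n ω, 0 ≤ b n ω)
    (hr : ∀ᶠ n in atTop, 0 ≤ r n)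
    (hexact : IsExactOrderInProb P (fun n ω => b n ω ^ 2) fun n _ => r n)
    (hab : ∀ δ > 0, ∀ η > 0, ∀ᶠ n in atTop,
      P n {ω | ¬(b n ω ≤ a n ω ∧ a n ω ≤ b n ω + η * √(r n))} ≤ ENNReal.ofReal δ) :
    IsEquivalentInProb P a b := by
  intro δ hδ
  rw [ENNReal.tendsto_nhds_zero]
  intro ε' hε'
  obtain ⟨ε, hε0, hε⟩ : ∃ ε : ℝ, 0 < ε ∧ ENNReal.ofReal ε ≤ ε' := by
    rcases eq_or_ne ε' ⊤ with rfl | h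
    · exact ⟨1, one_pos, le_top⟩
    · exact ⟨ε'.toReal, ENNReal.toReal_pos hε'.ne' h, by rw [ENNReal.ofReal_toReal h]⟩
  obtain ⟨K, hK, hKn⟩ := hexact.2 (ε / 2) (by positivity)
  filter_upwards [hr, hKn, hab (ε / 2) (by positivity) (δ / √K) (by positivity)] with n hrn h1 h2
  refine le_trans ?_ hε
  rw [show ε = ε / 2 + ε / 2 by ring, ENNReal.ofReal_add (by positivity) (by positivity)]
  refine (measure_mono ?_).trans ((measure_union_le _ _).trans (add_le_add h1 h2))
  intro ω hω
  simp only [Set.mem_union, Set.mem_ofPred_eq] at hω ⊢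
  by_contra! hcon
  obtain ⟨hc1, hc2, hc3⟩ := hcon
  rw [abs_sq, abs_of_nonneg hrn] at hc1
  rw [abs_of_nonneg (hb n ω), abs_of_nonneg (by linarith)] at hω
  have : √(r n) ≤ √K * b n ω := by
    rw [Real.sqrt_le_left (by have := hb n ω; positivity), mul_pow, Real.sq_sqrt hK.le]
    exact hc1
  have h3 : δ / √K * √(r n) ≤ δ * b n ω := by
    calc _ ≤ δ / √K * (√K * b n ω) := by gcongr
      _ = _ := by
        have : √K ≠ 0 := by positivity
        field_simp
  linarith

/-- The exact order of `b²` passes to `a²` if `b ≤ a ≤ b + o_P(√r)`. -/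
lemma IsExactOrderInProb.of_le_add (ha : ∀ n ω, 0 ≤ a n ω) (hb : ∀ n ω, 0 ≤ b n ω)
    (hr : ∀ᶠ n in atTop, 0 ≤ r n)
    (hexact : IsExactOrderInProb P (fun n ω => b n ω ^ 2) fun n _ => r n)
    (hab : ∀ δ > 0, ∀ η > 0, ∀ᶠ n in atTop,
      P n {ω | ¬(b n ω ≤ a n ω ∧ a n ω ≤ b n ω + η * √(r n))} ≤ ENNReal.ofReal δ) :
    IsExactOrderInProb P (fun n ω => a n ω ^ 2) fun n _ => r n := by
  refine ⟨fun δ hδ => ?_, fun δ hδ => ?_⟩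
  · obtain ⟨K, hK, hKn⟩ := hexact.1 (δ / 2) (by positivity)
    refine ⟨2 * K + 2, by positivity, ?_⟩
    filter_upwards [hr, hKn, hab (δ / 2) (by positivity) 1 one_pos] with n hrn h1 h2
    rw [show δ = δ / 2 + δ / 2 by ring, ENNReal.ofReal_add (by positivity) (by positivity)]
    refine (measure_mono ?_).trans ((measure_union_le _ _).trans (add_le_add h1 h2))
    intro ω hω
    simp only [Set.mem_union, Set.mem_ofPred_eq, abs_sq, abs_of_nonneg hrn] at hω ⊢
    by_contra! hcon
    obtain ⟨hc1, hc2, hc3⟩ := hcon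
    have := Real.sq_sqrt hrn
    have h4 : a n ω ^ 2 ≤ (b n ω + 1 * √(r n)) ^ 2 := by gcongr; exact ha n ω
    nlinarith [sq_nonneg (b n ω - √(r n))]
  · obtain ⟨K, hK, hKn⟩ := hexact.2 (δ / 2) (by positivity)
    refine ⟨K, hK, ?_⟩
    filter_upwards [hr, hKn, hab (δ / 2) (by positivity) 1 one_pos] with n hrn h1 h2
    rw [show δ = δ / 2 + δ / 2 by ring, ENNReal.ofReal_add (by positivity) (by positivity)]
    refine (measure_mono ?_).trans ((measure_union_le _ _).trans (add_le_add h1 h2))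
    intro ω hω
    simp only [Set.mem_union, Set.mem_ofPred_eq, abs_sq, abs_of_nonneg hrn] at hω ⊢
    by_contra! hcon
    obtain ⟨hc1, hc2, hc3⟩ := hcon
    have h4 : b n ω ^ 2 ≤ a n ω ^ 2 := by gcongr; exact hb n ω
    have := mul_le_mul_of_nonneg_left h4 hK.le
    linarith

/-- A uniform upper bound together with one sequence of parameters at which the loss is of exact
order `r` gives the exact worst-case rate. -/
lemma HasExactWorstCaseRate.of_isExactOrderInProb {Θ : ℕ → Type} {Q : ∀ n, Θ n → Measure (Ω n)}
    {L : ∀ n, Θ n → Ω n → ℝ} {C : ∀ n, Set (Θ n)} (hr : ∀ᶠ n in atTop, 0 ≤ r n)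
    (hL : ∀ n θ ω, 0 ≤ L n θ ω)
    (hupper : ∀ δ > 0, ∃ K > 0, ∀ᶠ n in atTop, ∀ θ ∈ C n,
      Q n θ {ω | K * r n < L n θ ω} ≤ ENNReal.ofReal δ) (θ : ∀ n, Θ n) (hθ : ∀ n, θ n ∈ C n)
    (hexact : IsExactOrderInProb (fun n => Q n (θ n)) (fun n ω => L n (θ n) ω) fun n _ => r n) :
    HasExactWorstCaseRate Q L C r := by
  refine ⟨hupper, fun δ hδ => ?_⟩
  obtain ⟨K, hK, hKn⟩ := hexact.2 δ hδ
  refine ⟨K⁻¹, by positivity, ?_⟩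
  filter_upwards [hr, hKn] with n hrn h
  refine ⟨θ n, hθ n, (measure_mono fun ω hω => ?_).trans h⟩
  simp only [Set.mem_ofPred_eq] at hω ⊢
  rwa [abs_of_nonneg (hL _ _ _), abs_of_nonneg hrn, ← lt_inv_mul_iff₀ hK]

/-- A uniform bound `O_P(r)` for `v²` passes to `u²` if `u ≤ v + √r` with probability close to one,
uniformly over the parameters. -/
lemma uniform_sq_le_of_le_add {Θ : ℕ → Type} {Q : ∀ n, Θ n → Measure (Ω n)}
    {u v : ∀ n, Θ n → Ω n → ℝ} {C : ∀ n, Set (Θ n)} (hr : ∀ᶠ n in atTop, 0 ≤ r n)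
    (hu : ∀ n θ ω, 0 ≤ u n θ ω)
    (huv : ∀ δ > 0, ∀ᶠ n in atTop, ∀ θ ∈ C n,
      Q n θ {ω | ¬(v n θ ω ≤ u n θ ω ∧ u n θ ω ≤ v n θ ω + √(r n))} ≤ ENNReal.ofReal δ)
    (hv : ∀ δ > 0, ∃ K > 0, ∀ᶠ n in atTop, ∀ θ ∈ C n,
      Q n θ {ω | K * r n < v n θ ω ^ 2} ≤ ENNReal.ofReal δ) :
    ∀ δ > 0, ∃ K > 0, ∀ᶠ n in atTop, ∀ θ ∈ C n,
      Q n θ {ω | K * r n < u n θ ω ^ 2} ≤ ENNReal.ofReal δ := by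
  intro δ hδ
  obtain ⟨K, hK, hKn⟩ := hv (δ / 2) (by positivity)
  refine ⟨2 * K + 2, by positivity, ?_⟩
  filter_upwards [hr, hKn, huv (δ / 2) (by positivity)] with n hrn h1 h2 θ hθ
  rw [show δ = δ / 2 + δ / 2 by ring, ENNReal.ofReal_add (by positivity) (by positivity)]
  refine (measure_mono ?_).trans ((measure_union_le _ _).trans (add_le_add (h1 θ hθ) (h2 θ hθ)))
  intro ω hω
  simp only [Set.mem_union, Set.mem_ofPred_eq] at hω ⊢
  by_contra! hcon
  obtain ⟨hc1, hc2, hc3⟩ := hcon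
  have := Real.sq_sqrt hrn
  have h4 : u n θ ω ^ 2 ≤ (v n θ ω + √(r n)) ^ 2 := by gcongr; exact hu n θ ω
  nlinarith [sq_nonneg (v n θ ω - √(r n))]

end InProbability

/-- If the error of the validation covariance `V` is nearly orthogonal, up to `τ`, to the errors of
all thresholded matrices of the grid, then the loss of the cross-validated threshold exceeds the
oracle loss by at most `2 τ`. -/
lemma IsGridMinimizer.norm_sub_le {p J j o : ℕ} {h τ : ℝ} {A V S : Matrix (Fin p) (Fin p) ℝ}
    (hτ0 : 0 ≤ τ) (hj : IsGridMinimizer J h A V j) (ho : IsGridMinimizer J h A S o)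
    (hτ : ∀ i ≤ J, |frobInner (hardThreshold (i * h) A - S) (V - S)| ≤
      τ * ‖hardThreshold (i * h) A - S‖) :
    ‖hardThreshold (o * h) A - S‖ ≤ ‖hardThreshold (j * h) A - S‖ ∧
      ‖hardThreshold (j * h) A - S‖ ≤ ‖hardThreshold (o * h) A - S‖ + 2 * τ := by
  have h1 := hj.2 o ho.1
  have h2 := (sq_le_sq₀ (norm_nonneg _) (norm_nonneg _)).mp (ho.2 j hj.1)
  refine ⟨h2, ?_⟩
  rw [norm_sub_sq_eq _ V S, norm_sub_sq_eq _ V S] at h1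
  have hj' := abs_le.mp (hτ j hj.1)
  have ho' := abs_le.mp (hτ o ho.1)
  set x := ‖hardThreshold (j * h) A - S‖
  set y := ‖hardThreshold (o * h) A - S‖
  have hy : 0 ≤ y := norm_nonneg _
  by_contra! hcon
  rcases eq_or_lt_of_le (show 0 ≤ x + y by linarith) with h0 | h0
  · linarith
  · have : (x - y) * (x + y) ≤ 2 * τ * (x + y) := by linarith [hj'.2, ho'.1]
    linarith [le_of_mul_le_mul_right this h0]

/-! ### Cross-validation against the oracle -/

lemma nonneg_of_mem_sparseClass {p : ℕ} {q c M : ℝ} {S : Matrix (Fin p) (Fin p) ℝ} (hp : 0 < p)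
    (hS : S ∈ sparseClass p q c M) : 0 ≤ c ∧ 0 ≤ M :=
  ⟨(Finset.sum_nonneg fun _ _ => absPow_nonneg _ _).trans (hS.2.2 ⟨0, hp⟩),
    hS.1.diag_nonneg.trans (hS.2.1 ⟨0, hp⟩)⟩

lemma rowSum_abs_le_of_mem_sparseClass_of_le {p : ℕ} {q c M C : ℝ}
    {S : Matrix (Fin p) (Fin p) ℝ} (hq1 : q < 1) (hc : c ≤ C) (hS : S ∈ sparseClass p q c M)
    (i : Fin p) : ∑ j, |S i j| ≤ |M| ^ (1 - q) * |C| := by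
  have hM : 0 ≤ M := (nonneg_of_mem_sparseClass i.pos hS).2
  refine (rowSum_abs_le_of_mem_sparseClass hq1 hS i).trans ?_
  rw [abs_of_nonneg hM]
  gcongr
  exact hc.trans (le_abs_self C)

lemma frobRate_nonneg {q c : ℝ} {n p : ℕ} (hc : 0 ≤ c) : 0 ≤ frobRate q c n p := by
  have : 0 ≤ Real.log (p : ℝ) := Real.log_natCast_nonneg p
  unfold frobRate
  positivity

lemma half_lt_log_of_two_le {k : ℕ} (hk : 2 ≤ k) : 1 / 2 < Real.log k := by
  have h1 : Real.log 2 ≤ Real.log k := Real.log_le_log two_pos (by exact_mod_cast hk)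
  linarith [Real.log_two_gt_d9]

/-- The growth condition on `log J`, in terms of the rate: `p (log J)³ / B = o(r)`. It also forces
`p ≥ 2` eventually, since for `p ≤ 1` its right-hand side is zero. -/
lemma eventually_log_pow_le {q : ℝ} (hq1 : q < 1) {c₀ : ℕ → ℝ} {p B J : ℕ → ℕ} {ε : ℕ → ℝ}
    (hBε : ∀ n, (B n : ℝ) = n * ε n) (hB : ∀ᶠ n in atTop, 0 < B n ∧ B n < n)
    (hJ : ∀ᶠ n in atTop, 2 ≤ J n)
    (hJB : (fun n : ℕ => Real.log (J n) ^ 3) =o[atTop] fun n : ℕ =>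
      (n : ℝ) ^ (q / 2) * c₀ (p n) * Real.log (p n) ^ (1 - q / 2) * ε n)
    (hc : ∀ n, 0 < p n → 0 ≤ c₀ (p n)) {D : ℝ} (hD : 0 < D) :
    ∀ᶠ n in atTop, (2 ≤ p n ∧ 0 < B n ∧ B n < n ∧ 2 ≤ J n) ∧
      p n * Real.log (J n) ^ 3 ≤ D * (frobRate q (c₀ (p n)) n (p n) * B n) := by
  filter_upwards [hJB.def hD, hB, hJ] with n h1 h2 h3
  have hlJ := half_lt_log_of_two_le h3
  have hp : 2 ≤ p n := by
    by_contra! hp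
    have h0 : Real.log (p n) = 0 := by
      interval_cases p n <;> simp
    rw [h0, Real.zero_rpow (by linarith), mul_zero, zero_mul, norm_zero, mul_zero,
      norm_le_zero_iff] at h1
    exact (pow_pos (by linarith : 0 < Real.log (J n)) 3).ne' h1
  refine ⟨⟨hp, h2.1, h2.2, h3⟩, ?_⟩
  have hn : (0 : ℝ) < n := by exact_mod_cast h2.1.trans h2.2
  have hp0 : (0 : ℝ) < p n := by exact_mod_cast (by omega : 0 < p n)
  have hlp : 0 ≤ Real.log (p n) := Real.log_natCast_nonneg _
  have hc0 := hc n (by omega)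
  have hε : 0 ≤ ε n := by
    have : (0 : ℝ) ≤ n * ε n := by rw [← hBε]; positivity
    exact nonneg_of_mul_nonneg_right this hn
  rw [Real.norm_of_nonneg (by positivity), Real.norm_of_nonneg (by positivity)] at h1
  have e : frobRate q (c₀ (p n)) n (p n) * B n =
      p n * ((n : ℝ) ^ (q / 2) * c₀ (p n) * Real.log (p n) ^ (1 - q / 2) * ε n) := by
    have hnq : (n : ℝ) ^ (q / 2) * (n : ℝ) ^ (1 - q / 2) = n := by
      rw [← Real.rpow_add hn]; simp
    have hn0 : (n : ℝ) ^ (1 - q / 2) ≠ 0 := (Real.rpow_pos_of_pos hn _).ne'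
    rw [frobRate, hBε, Real.div_rpow hlp hn.le]
    have hnε : n * ε n = (n : ℝ) ^ (q / 2) * (n : ℝ) ^ (1 - q / 2) * ε n := by rw [hnq]
    rw [hnε]
    field_simp
  rw [e]
  have := mul_le_mul_of_nonneg_left h1 hp0.le
  linarith

/-- The deviation `τ = 2 t κ + s / b` with `t = K L / √b` is small compared with `√r`. -/
lemma two_mul_deviation_le {L K κ G b p r s η : ℝ} (hη : 0 < η) (hL : 1 / 2 < L) (hb : 1 ≤ b)
    (hp : 1 ≤ p) (hG : 0 ≤ G) (hr0 : 0 ≤ r) (hs : s ^ 2 ≤ p * G)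
    (hr : p * L ^ 3 ≤ η ^ 2 / (4 * (32 * (κ * K) ^ 2 + 32 * G + 1)) * (r * b)) :
    2 * (2 * (K * L / √b) * κ + s / b) ≤ η * √r := by
  have hbpos : 0 < b := by linarith
  have hL0 : 0 < L := by linarith
  have hLsq : L ^ 2 ≤ 2 * L ^ 3 := by
    have : 0 ≤ L ^ 2 * (2 * L - 1) := mul_nonneg (sq_nonneg L) (by linarith)
    linarith
  have hL3 : 1 ≤ 8 * L ^ 3 := by
    have : (1 / 2 : ℝ) ^ 3 ≤ L ^ 3 := by gcongr
    linarith
  set t := K * L / √b with ht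
  have htsq : t ^ 2 = (K * L) ^ 2 / b := by
    rw [ht, div_pow, Real.sq_sqrt hbpos.le]
  refine abs_le_of_sq_le_sq' ?_ (by positivity) |>.2
  rw [mul_pow η, Real.sq_sqrt hr0]
  have hs1 : (2 * (2 * t * κ + s / b)) ^ 2 ≤
      2 * (16 * κ ^ 2 * t ^ 2) + 2 * (4 * (s ^ 2 / b ^ 2)) := by
    rw [← div_pow]
    have := sq_nonneg (4 * κ * t - 2 * (s / b))
    linarith
  have hs2 : s ^ 2 / b ^ 2 ≤ 8 * G * (p * L ^ 3 / b) := by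
    calc s ^ 2 / b ^ 2 ≤ p * G / b := by
          gcongr
          exact le_self_pow₀ hb two_ne_zero
      _ ≤ p * G * (8 * L ^ 3) / b := by
          refine div_le_div_of_nonneg_right ?_ hbpos.le
          exact le_mul_of_one_le_right (by positivity) hL3
      _ = _ := by ring
  have hs3 : t ^ 2 ≤ 2 * K ^ 2 * (p * L ^ 3 / b) := by
    rw [htsq]
    calc (K * L) ^ 2 / b = K ^ 2 * L ^ 2 / b := by ring
      _ ≤ K ^ 2 * (2 * L ^ 3) / b := by gcongr
      _ ≤ K ^ 2 * (2 * L ^ 3) * p / b := by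
          refine div_le_div_of_nonneg_right ?_ hbpos.le
          exact le_mul_of_one_le_right (by positivity) hp
      _ = _ := by ring
  have hs4 : p * L ^ 3 / b ≤ η ^ 2 / (4 * (32 * (κ * K) ^ 2 + 32 * G + 1)) * r := by
    rw [div_le_iff₀ hbpos]; linarith
  set w := p * L ^ 3 / b
  have hw : 0 ≤ w := by positivity
  have h1 := mul_nonneg (sq_nonneg (κ * K)) hw
  have h2 := mul_nonneg hG hw
  calc _ ≤ 2 * (16 * κ ^ 2 * (2 * K ^ 2 * w)) + 2 * (4 * (8 * G * w)) := by
        refine hs1.trans ?_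
        gcongr
    _ ≤ 4 * (32 * (κ * K) ^ 2 + 32 * G + 1) * w := by linarith
    _ ≤ 4 * (32 * (κ * K) ^ 2 + 32 * G + 1) *
        (η ^ 2 / (4 * (32 * (κ * K) ^ 2 + 32 * G + 1)) * r) := by gcongr
    _ = η ^ 2 * r := by
        have : 4 * (32 * (κ * K) ^ 2 + 32 * G + 1) ≠ 0 := by positivity
        field_simp

/-- The union bound over a grid of `J + 1` thresholds, with deviations of order `log J / √b`. -/
lemma union_tail_le {J : ℕ} {a b : ℝ} (hJ : 2 ≤ J) (ha : 0 ≤ a) (hb : 1 ≤ b) :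
    ((J : ℝ) + 1) * (4 * Real.exp (-(b * (16 * (1 + a) * Real.log J / √b) *
      min (16 * (1 + a) * Real.log J / √b) 1 / 16))) ≤ 8 * Real.exp (-(a * Real.log 2)) := by
  have hbpos : 0 < b := by linarith
  have hLhalf := half_lt_log_of_two_le hJ
  set L := Real.log J with hL
  set u := 16 * (1 + a) * L with hu
  set t := u / √b with ht
  have hu1 : 1 ≤ u := by
    have : 0 ≤ a * L := mul_nonneg ha (by linarith)
    linarith
  have hsq : 1 ≤ √b := Real.one_le_sqrt.mpr hb
  have hbt : b * t = √b * u := by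
    rw [ht]
    nth_rewrite 1 [← Real.mul_self_sqrt hbpos.le]
    field_simp
  have hmin : u ≤ b * t * min t 1 := by
    rcases min_cases t 1 with ⟨h, _⟩ | ⟨h, _⟩ <;> rw [h]
    · have : b * t * t = u ^ 2 := by
        rw [hbt, ht]
        field_simp
      rw [this]
      exact le_self_pow₀ hu1 two_ne_zero
    · rw [hbt, mul_one]
      exact le_mul_of_one_le_left (by linarith) hsq
  have hJpos : (0 : ℝ) < J := by exact_mod_cast (by omega : 0 < J)
  have hJ1 : (1 : ℝ) ≤ J := by exact_mod_cast (by omega : 1 ≤ J)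
  have hL2 : Real.log 2 ≤ L := Real.log_le_log two_pos (by exact_mod_cast hJ)
  calc ((J : ℝ) + 1) * (4 * Real.exp (-(b * t * min t 1 / 16)))
      ≤ (2 * J) * (4 * Real.exp (-(u / 16))) := by gcongr; linarith
    _ = 8 * (Real.exp L * Real.exp (-(u / 16))) := by
        rw [hL, Real.exp_log hJpos]; ring
    _ = 8 * Real.exp (-(a * L)) := by
        rw [← Real.exp_add, hu]; ring_nf
    _ ≤ 8 * Real.exp (-(a * Real.log 2)) := by gcongr

section Uniform

variable {q M : ℝ} {c₀ : ℕ → ℝ} {p B J : ℕ → ℕ} {ε : ℕ → ℝ}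

/-- Uniform comparison of the cross-validated and the oracle threshold: the square roots of the
losses differ by `o_P(√r)`, uniformly over the sparse class. -/
theorem eventually_crossValidation_le_oracle (hq1 : q < 1) (hc₀ : ∃ C : ℝ, ∀ k, c₀ k ≤ C)
    (hrate : ∀ D : ℝ, 0 < D → ∀ᶠ n in atTop, (2 ≤ p n ∧ 0 < B n ∧ B n < n ∧ 2 ≤ J n) ∧
      p n * Real.log (J n) ^ 3 ≤ D * (frobRate q (c₀ (p n)) n (p n) * B n))
    {jcv : ∀ n, Sample n (p n) → ℕ}
    (hjcv : ∀ n X, IsGridMinimizer (J n) (gridStep n (p n))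
      (trainCov (B n) X) (validCov (B n) X) (jcv n X))
    {jor : ∀ n, Matrix (Fin (p n)) (Fin (p n)) ℝ → Sample n (p n) → ℕ}
    (hjor : ∀ n A X, IsGridMinimizer (J n) (gridStep n (p n)) (trainCov (B n) X) A (jor n A X))
    {δ η : ℝ} (hδ : 0 < δ) (hη : 0 < η) :
    ∀ᶠ n in atTop, ∀ θ : EuclideanSpace ℝ (Fin (p n)) × Matrix (Fin (p n)) (Fin (p n)) ℝ,
      θ.2 ∈ sparseClass (p n) q (c₀ (p n)) M → gaussianSample n θ.1 θ.2
        {X | ¬(‖hardThreshold (jor n θ.2 X * gridStep n (p n)) (trainCov (B n) X) - θ.2‖ ≤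
            ‖hardThreshold (jcv n X * gridStep n (p n)) (trainCov (B n) X) - θ.2‖ ∧
          ‖hardThreshold (jcv n X * gridStep n (p n)) (trainCov (B n) X) - θ.2‖ ≤
            ‖hardThreshold (jor n θ.2 X * gridStep n (p n)) (trainCov (B n) X) - θ.2‖ +
              η * √(frobRate q (c₀ (p n)) n (p n)))} ≤ ENNReal.ofReal δ := by
  obtain ⟨C, hC⟩ := hc₀
  set κ : ℝ := |M| ^ (1 - q) * |C| + 1
  have hκ0 : 0 < κ := by positivity
  set G : ℝ := |M| ^ (2 - q) * |C| with hG
  have hG0 : 0 ≤ G := by positivity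
  -- `a` makes the union bound `(J + 1) · 4 exp(-(1 + a) log J)` smaller than `δ`
  obtain ⟨a, ha0, ha⟩ : ∃ a : ℝ, 0 ≤ a ∧ 8 * Real.exp (-(a * Real.log 2)) ≤ δ := by
    refine ⟨max 0 (Real.log (8 / δ) / Real.log 2), le_max_left _ _, ?_⟩
    have h2 : 0 < Real.log 2 := Real.log_pos one_lt_two
    have h : Real.log (8 / δ) ≤ max 0 (Real.log (8 / δ) / Real.log 2) * Real.log 2 := by
      rw [← div_le_iff₀ h2]; exact le_max_right _ _
    calc _ ≤ 8 * Real.exp (-Real.log (8 / δ)) := by gcongr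
      _ = δ := by rw [Real.exp_neg, Real.exp_log (by positivity)]; field_simp
  set K : ℝ := 16 * (1 + a) with hK
  have hKpos : 0 < K := by linarith
  filter_upwards [hrate (η ^ 2 / (4 * (32 * (κ * K) ^ 2 + 32 * G + 1))) (by positivity)]
    with n hn θ hθ
  obtain ⟨⟨hp, hB0, hBn, hJ2⟩, hr⟩ := hn
  obtain ⟨hc0, hM0⟩ := nonneg_of_mem_sparseClass (by omega) hθ
  set L := Real.log (J n) with hL
  have hLhalf : 1 / 2 < L := half_lt_log_of_two_le hJ2
  have hB1 : (1 : ℝ) ≤ B n := by exact_mod_cast hB0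
  have hBpos : (0 : ℝ) < B n := by linarith
  have hp1 : (1 : ℝ) ≤ p n := by exact_mod_cast (by omega : 1 ≤ p n)
  set r := frobRate q (c₀ (p n)) n (p n) with hrdef
  have hr0 : 0 ≤ r := frobRate_nonneg hc0
  have hcC : c₀ (p n) ≤ |C| := (hC _).trans (le_abs_self C)
  have hrow (i : Fin (p n)) : ∑ j, |θ.2 i j| ≤ κ :=
    (rowSum_abs_le_of_mem_sparseClass_of_le hq1 (hC _) hθ i).trans
      (le_add_of_nonneg_right zero_le_one)
  have hnorm : ‖θ.2‖ ^ 2 ≤ p n * G := by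
    refine (norm_sq_le_of_mem_sparseClass hq1 hθ).trans ?_
    rw [hG, abs_of_nonneg hM0]
    gcongr
  set t := K * L / √(B n) with ht
  have ht0 : 0 < t := div_pos (mul_pos hKpos (by linarith)) (Real.sqrt_pos.mpr hBpos)
  have hprob := measure_exists_frobInner_validCov_le (J := J n) hB0 hBn θ.1 hθ.1 hκ0 hrow ht0
    (gridStep n (p n))
  -- the selected indices need not be measurable in the data: the event is covered by a measurable one
  refine (measure_mono ?_).trans (hprob.trans (ENNReal.ofReal_le_ofReal ?_))
  · intro X hX
    simp only [Set.mem_ofPred_eq] at hX ⊢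
    by_contra! hcon
    obtain ⟨h1, h2⟩ := (hjcv n X).norm_sub_le (by positivity) (hjor n θ.2 X) hcon
    refine hX ⟨h1, h2.trans (add_le_add le_rfl ?_)⟩
    exact two_mul_deviation_le hη hLhalf hB1 hp1 hG0 hr0 hnorm hr
  · refine (?_ : _ ≤ 8 * Real.exp (-(a * Real.log 2))).trans ha
    exact union_tail_le hJ2 ha0 hB1

end Uniform

/-! ### Uniform upper bound for the oracle -/

section Uniform

variable {q M : ℝ} {c₀ : ℕ → ℝ} {p B J : ℕ → ℕ} {ε : ℕ → ℝ}

/-- The oracle loss is `O_P(r)` uniformly over the sparse class: the grid contains a threshold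
`K √(log p / n)` that dominates all entrywise errors of the training covariance with probability
close to one. -/
theorem uniform_oracle_le (hq0 : 0 ≤ q) (hq1 : q < 1) (hc₀ : ∃ C : ℝ, ∀ k, c₀ k ≤ C)
    (hBε : ∀ n, (B n : ℝ) = n * ε n)
    (hn : ∀ᶠ n in atTop, 2 ≤ p n ∧ 0 < B n ∧ B n < n ∧ 2 ≤ J n)
    {jor : ∀ n, Matrix (Fin (p n)) (Fin (p n)) ℝ → Sample n (p n) → ℕ}
    (hjor : ∀ n A X, IsGridMinimizer (J n) (gridStep n (p n)) (trainCov (B n) X) A (jor n A X))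
    (hlog : Tendsto (fun n : ℕ => Real.log (p n) / n) atTop (𝓝 0)) (hJ : Tendsto J atTop atTop)
    (hε : ∃ ε₁ < 1, ∀ᶠ n in atTop, ε n ≤ ε₁) {δ : ℝ} (hδ : 0 < δ) :
    ∃ K > 0, ∀ᶠ n in atTop,
      ∀ θ : EuclideanSpace ℝ (Fin (p n)) × Matrix (Fin (p n)) (Fin (p n)) ℝ,
      θ.2 ∈ sparseClass (p n) q (c₀ (p n)) M → gaussianSample n θ.1 θ.2
        {X | K * frobRate q (c₀ (p n)) n (p n) <
          ‖hardThreshold (jor n θ.2 X * gridStep n (p n)) (trainCov (B n) X) - θ.2‖ ^ 2} ≤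
        ENNReal.ofReal δ := by
  obtain ⟨C, hC⟩ := hc₀
  obtain ⟨ε₁, hε1, hε⟩ := hε
  set κ : ℝ := |M| ^ (1 - q) * |C| + 1
  have hκ0 : 0 < κ := by positivity
  set a := 1 - ε₁ with ha
  have ha0 : 0 < a := by linarith
  -- the exponent of the tail bound is `d K² log p`, and `K` makes `4 p² exp(-d K² log p) ≤ δ`
  set d : ℝ := a / (1024 * κ ^ 2) with hd
  have hd0 : 0 < d := by positivity
  obtain ⟨K, hK1, hK⟩ : ∃ K : ℕ, 1 ≤ K ∧
      2 + max 0 (Real.log (4 / δ) / Real.log 2) ≤ d * (K : ℝ) ^ 2 := by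
    obtain ⟨k, hk⟩ := exists_nat_ge ((2 + max 0 (Real.log (4 / δ) / Real.log 2)) / d)
    refine ⟨k + 1, by omega, ?_⟩
    rw [div_le_iff₀ hd0] at hk
    have h1 : (k : ℝ) ≤ ((k + 1 : ℕ) : ℝ) ^ 2 := by
      push_cast
      nlinarith [Nat.cast_nonneg (α := ℝ) k]
    have := mul_le_mul_of_nonneg_left h1 hd0.le
    linarith
  have hKpos : (0 : ℝ) < K := by exact_mod_cast hK1
  refine ⟨9 / 4 * (K : ℝ) ^ (2 - q), by positivity, ?_⟩
  have hstep : ∀ᶠ n : ℕ in atTop, Real.log (p n) / n ≤ (8 * κ / K) ^ 2 :=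
    hlog.eventually_le_const (by positivity)
  filter_upwards [hn, hε, hstep, hJ.eventually_ge_atTop K,
    eventually_ge_atTop ⌈32 * M ^ 2 / a ^ 2⌉₊] with n hn hεn hstep hKJ hnM θ hθ
  obtain ⟨hp, hB0, hBn, hJ2⟩ := hn
  obtain ⟨hc0, hM0⟩ := nonneg_of_mem_sparseClass (by omega) hθ
  have hn0 : (0 : ℝ) < n := by exact_mod_cast hB0.trans hBn
  have hlp : 1 / 2 < Real.log (p n) := half_lt_log_of_two_le hp
  have hrow (i : Fin (p n)) : ∑ j, |θ.2 i j| ≤ κ :=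
    (rowSum_abs_le_of_mem_sparseClass_of_le hq1 (hC _) hθ i).trans
      (le_add_of_nonneg_right zero_le_one)
  set h := gridStep n (p n) with hh
  have hh2 : h ^ 2 = Real.log (p n) / n := Real.sq_sqrt (by positivity)
  have hh0 : 0 < h := Real.sqrt_pos.mpr (by positivity)
  set I : Finset (Fin n) := Finset.univ.filter fun k : Fin n => (k : ℕ) + B n < n with hI
  have hcard : I.card = n - B n := card_trainIndices
  have hIne : I.Nonempty := Finset.card_pos.mp (by omega)
  have hm : a * n ≤ (I.card : ℝ) := by
    rw [hcard, Nat.cast_sub hBn.le, hBε, ha]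
    nlinarith
  have hm0 : (0 : ℝ) < I.card := lt_of_lt_of_le (by positivity) hm
  set t := K * h / (8 * κ) with ht
  have ht0 : 0 < t := by positivity
  have ht1 : t ≤ 1 := by
    have : h ≤ 8 * κ / K := abs_le_of_sq_le_sq' (by rw [hh2]; exact hstep) (by positivity) |>.2
    rw [ht, div_le_one (by positivity)]
    rwa [le_div_iff₀ hKpos, mul_comm] at this
  -- the bias of the sample covariance is negligible
  have hbias : M / I.card ≤ K * h / 4 := by
    have hnM' : 32 * M ^ 2 ≤ n * a ^ 2 := by
      have := Nat.ceil_le.mp hnM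
      rwa [div_le_iff₀ (by positivity)] at this
    have h1 : M / (a * n) ≤ h / 4 := by
      refine abs_le_of_sq_le_sq' ?_ (by positivity) |>.2
      rw [div_pow, div_pow, hh2, mul_pow, div_div, div_le_div_iff₀ (by positivity) (by positivity)]
      have h2 : 0 ≤ (n : ℝ) * (n * a ^ 2 - 32 * M ^ 2) := mul_nonneg hn0.le (by linarith)
      have h3 : 0 ≤ (Real.log (p n) - 1 / 2) * (a ^ 2 * (n : ℝ) ^ 2) :=
        mul_nonneg (by linarith) (by positivity)
      nlinarith
    calc M / I.card ≤ M / (a * n) := by gcongr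
      _ ≤ h / 4 := h1
      _ ≤ K * h / 4 := by
        gcongr
        exact le_mul_of_one_le_left hh0.le (by exact_mod_cast hK1)
  have hprob := measureReal_exists_abs_sampleCov_sub_le θ.1 hθ.1 hIne hκ0 hrow hθ.2.1 ht0
  rw [← ofReal_measureReal]
  refine ENNReal.ofReal_le_ofReal (le_trans (measureReal_mono ?_ (measure_ne_top _ _))
    (hprob.trans ?_))
  · intro X hX
    simp only [Set.mem_ofPred_eq] at hX ⊢
    by_contra! hcon
    refine absurd hX (not_lt.mpr ?_)
    have hA (i j : Fin (p n)) : |trainCov (B n) X i j - θ.2 i j| ≤ K * h / 2 := by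
      refine (hcon i j).trans ?_
      have : 2 * t * κ = K * h / 4 := by rw [ht]; field_simp; ring
      linarith
    refine ((hjor n θ.2 X).2 K hKJ).trans
      ((norm_hardThreshold_sub_sq_le hq0 hq1 hθ (by positivity) hA).trans_eq ?_)
    have hpow : h ^ (2 - q) = (Real.log (p n) / n) ^ (1 - q / 2) := by
      rw [← hh2, ← Real.rpow_natCast_mul hh0.le]
      congr 1
      push_cast
      ring
    rw [Real.mul_rpow hKpos.le hh0.le, hpow, frobRate]
    ring
  · have hp0 : (0 : ℝ) < p n := by exact_mod_cast (by omega : 0 < p n)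
    have hexp : d * K ^ 2 * Real.log (p n) ≤ I.card * t * min t 1 / 16 := by
      rw [min_eq_left ht1]
      have e : d * K ^ 2 * Real.log (p n) = a * n * t * t / 16 := by
        have : Real.log (p n) = h ^ 2 * n := by rw [hh2]; field_simp
        rw [this, ht, hd]
        field_simp
        ring
      rw [e]
      gcongr
    have hlp2 : Real.log 2 ≤ Real.log (p n) := Real.log_le_log two_pos (by exact_mod_cast hp)
    have hl2 : 0 < Real.log 2 := Real.log_pos one_lt_two
    set v := max 0 (Real.log (4 / δ) / Real.log 2) with hv
    have hv0 : 0 ≤ v := le_max_left _ _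
    have hvl : Real.log (4 / δ) ≤ v * Real.log 2 := by
      rw [← div_le_iff₀ hl2]; exact le_max_right _ _
    have hp2 : (p n : ℝ) ^ 2 = Real.exp (2 * Real.log (p n)) := by
      rw [two_mul, Real.exp_add, Real.exp_log hp0, sq]
    have h1 : (2 + v) * Real.log (p n) ≤ d * K ^ 2 * Real.log (p n) := by gcongr
    have h2 : v * Real.log 2 ≤ v * Real.log (p n) := by gcongr
    calc (p n : ℝ) ^ 2 * (4 * Real.exp (-(I.card * t * min t 1 / 16)))
        = 4 * Real.exp (2 * Real.log (p n) + -(I.card * t * min t 1 / 16)) := by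
          rw [Real.exp_add, hp2]; ring
      _ ≤ 4 * Real.exp (-Real.log (4 / δ)) := by
          gcongr
          linarith
      _ = δ := by rw [Real.exp_neg, Real.exp_log (by positivity)]; field_simp

end Uniform

end

theorem theorem4
    (q M : ℝ) (hq0 : 0 ≤ q) (hq1 : q < 1)
    (c₀ : ℕ → ℝ) (hc₀ : ∃ C : ℝ, ∀ k, c₀ k ≤ C)
    (p B J : ℕ → ℕ) (ε : ℕ → ℝ)
    (hBε : ∀ n, (B n : ℝ) = n * ε n)
    (hB : ∀ᶠ n in atTop, 0 < B n ∧ B n < n)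
    (hJ : ∀ᶠ n in atTop, 2 ≤ J n)
    (hJB : (fun n : ℕ => Real.log (J n) ^ 3) =o[atTop] fun n : ℕ =>
      (n : ℝ) ^ (q / 2) * c₀ (p n) * Real.log (p n) ^ (1 - q / 2) * ε n)
    -- the true mean vectors and covariance matrices
    (ν : ∀ n, EuclideanSpace ℝ (Fin (p n)))
    (S : ∀ n, Matrix (Fin (p n)) (Fin (p n)) ℝ)
    (hS : ∀ n, S n ∈ sparseClass (p n) q (c₀ (p n)) M)
    -- grid index of the cross-validated threshold, as a function of the data
    (jcv : ∀ n, Sample n (p n) → ℕ)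
    (hjcv : ∀ n X, IsGridMinimizer (J n) (gridStep n (p n))
      (trainCov (B n) X) (validCov (B n) X) (jcv n X))
    -- grid index of the oracle threshold, as a function of the true covariance and the data
    (jor : ∀ n, Matrix (Fin (p n)) (Fin (p n)) ℝ → Sample n (p n) → ℕ)
    (hjor : ∀ n A X, IsGridMinimizer (J n) (gridStep n (p n)) (trainCov (B n) X) A (jor n A X))
    -- the oracle loss at `S` is of the exact order of the rate
    (hexact : IsExactOrderInProb (fun n => gaussianSample n (ν n) (S n))
      (fun n X => ‖hardThreshold (jor n (S n) X * gridStep n (p n)) (trainCov (B n) X) - S n‖ ^ 2)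
      (fun n _ => frobRate q (c₀ (p n)) n (p n))) :
    IsEquivalentInProb (fun n => gaussianSample n (ν n) (S n))
      (fun n X => ‖hardThreshold (jcv n X * gridStep n (p n)) (trainCov (B n) X) - S n‖)
      (fun n X => ‖hardThreshold (jor n (S n) X * gridStep n (p n)) (trainCov (B n) X) - S n‖) ∧
    IsExactOrderInProb (fun n => gaussianSample n (ν n) (S n))
      (fun n X => ‖hardThreshold (jcv n X * gridStep n (p n)) (trainCov (B n) X) - S n‖ ^ 2)
      (fun n _ => frobRate q (c₀ (p n)) n (p n)) ∧
    -- the worst case over the class, for the cross-validated and for the oracle threshold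
    (Tendsto (fun n : ℕ => Real.log (p n) / n) atTop (𝓝 0) → Tendsto J atTop atTop →
      (∃ ε₁ < 1, ∀ᶠ n in atTop, ε n ≤ ε₁) →
      HasExactWorstCaseRate
        (Θ := fun n => EuclideanSpace ℝ (Fin (p n)) × Matrix (Fin (p n)) (Fin (p n)) ℝ)
        (fun n θ => gaussianSample n θ.1 θ.2)
        (fun n θ X => ‖hardThreshold (jcv n X * gridStep n (p n)) (trainCov (B n) X) - θ.2‖ ^ 2)
        (fun n => {θ | θ.2 ∈ sparseClass (p n) q (c₀ (p n)) M})
        (fun n => frobRate q (c₀ (p n)) n (p n)) ∧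
      HasExactWorstCaseRate
        (Θ := fun n => EuclideanSpace ℝ (Fin (p n)) × Matrix (Fin (p n)) (Fin (p n)) ℝ)
        (fun n θ => gaussianSample n θ.1 θ.2)
        (fun n θ X =>
          ‖hardThreshold (jor n θ.2 X * gridStep n (p n)) (trainCov (B n) X) - θ.2‖ ^ 2)
        (fun n => {θ | θ.2 ∈ sparseClass (p n) q (c₀ (p n)) M})
        (fun n => frobRate q (c₀ (p n)) n (p n))) := by
  have hc (n : ℕ) (hp : 0 < p n) : 0 ≤ c₀ (p n) := (nonneg_of_mem_sparseClass hp (hS n)).1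
  have hrate (D : ℝ) (hD : 0 < D) := eventually_log_pow_le hq1 hBε hB hJ hJB hc hD
  have hsize := (hrate 1 one_pos).mono fun n h => h.1
  have hr : ∀ᶠ n in atTop, 0 ≤ frobRate q (c₀ (p n)) n (p n) :=
    hsize.mono fun n h => frobRate_nonneg (hc n (by omega))
  have hcmp (δ : ℝ) (hδ : 0 < δ) (η : ℝ) (hη : 0 < η) :=
    eventually_crossValidation_le_oracle (M := M) hq1 hc₀ hrate hjcv hjor hδ hη
  have hcmpS (δ : ℝ) (hδ : 0 < δ) (η : ℝ) (hη : 0 < η) :=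
    (hcmp δ hδ η hη).mono fun n h => h (ν n, S n) (hS n)
  have hexact_cv := hexact.of_le_add (fun n X => norm_nonneg _) (fun n X => norm_nonneg _) hr hcmpS
  refine ⟨hexact.isEquivalentInProb (fun n X => norm_nonneg _) hr hcmpS, hexact_cv, ?_⟩
  intro hlog hJtop hε
  have hupper (δ : ℝ) (hδ : 0 < δ) :=
    uniform_oracle_le (M := M) hq0 hq1 hc₀ hBε hsize hjor hlog hJtop hε hδ
  refine ⟨HasExactWorstCaseRate.of_isExactOrderInProb hr (fun n θ X => sq_nonneg _) ?_
      (fun n => (ν n, S n)) hS hexact_cv,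
    HasExactWorstCaseRate.of_isExactOrderInProb hr (fun n θ X => sq_nonneg _) hupper
      (fun n => (ν n, S n)) hS hexact⟩
  refine uniform_sq_le_of_le_add hr (fun n θ X => norm_nonneg _) (fun δ hδ => ?_) hupper
  have h := hcmp δ hδ 1 one_pos
  simp only [one_mul] at h
  exact h
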